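/- Let $\tau$ be in the upper half plane, $L=\mathbb Z+\mathbb Z\tau$, $E=\mathbb C/L$, and write $P_\alpha\in E$ for the image of $\alpha\in\mathbb C$. Let $D$ be a principal divisor on $E$, i.e. the divisor of a nonzero elliptic function for $L$, let $m_0$ be the multiplicity of $P_0$ in $D$, and let $f_D$ be the unique elliptic function with divisor $D$ and $f_D(z)=z^{m_0}(1+O(z))$ near $z=0$. Let $\zeta(z)=\frac1z+\sum_{0\ne\omega\in L}\bigl[\frac1{z-\omega}+\frac1\omega+\frac z{\omega^2}\bigr]$ be the Weierstrass zeta function of $L$. For an integer $j\ge1$ and $\alpha\in\mathbb C$ let $E_j(\tau,\alpha)$ be the value at $s=0$ of the analytic continuation of $$E_j(\tau,\alpha;s)=\sum_{\omega\in L,\ \omega\neq-\alpha}\frac1{(\alpha+\omega)^j|\alpha+\omega|^{2s}}\qquad(\operatorname{Re}s>1-j/2).$$ A lift of $D$ is a finite formal sum $\sum_\alpha m_\alpha(\alpha)$ of points $\alpha\in\mathbb C$ with $m_\alpha\in\mathbb Z$ and $\sum_\alpha m_\alpha(P_\alpha)=D$. Put $E_j(\tau,D)=\sum_\alpha m_\alpha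 E_j(\tau,\alpha)$ for any lift of $D$; this does not depend on the lift. Theorem 2.8. Let $\tilde D=\sum_\alpha m_\alpha(\alpha)$ be a lift of $D$ such that $\sum_\alpha m_\alpha=0$ and $\sum_\alpha m_\alpha\alpha=0$ in $\mathbb C$, and such that no $\alpha\in L\setminus\{0\}$ occurs in $\tilde D$ with $m_\alpha\neq0$. Then, at all $z\in\mathbb C$ that lie in no $\alpha+L$ with $m_\alpha\ne0$, $$\frac{df_D}{f_D}=\sum_\alpha m_\alpha\,\zeta(z-\alpha)\,dz=\sum_{\omega\in L}\Bigl[\sum_\alpha\frac{m_\alpha}{z-\alpha-\omega}\Bigr]dz .$$ The series over $\omega$ converges absolutely, and locally uniformly in $z$; for $z$ in a fixed compact subset of $\mathbb C$ its terms are $O(|\omega|^{-3})$ for large $|\omega|$, uniformly in $z$. If moreover $D$ is supported on the $\ell$-torsion points $E[\ell]$ for some integer $\ell\ge1$, then the Laurent expansion of $df_D/f_D$ near $z=0$ is $$\frac{df_D}{f_D}=\Bigl(\frac{m_0}z-\sum_{j\ge1}E_j(\tau,D)\,z^{j-1}\Bigr)dz .$$ -/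

import Mathlib

open scoped Topology Asymptotics

noncomputable section

namespace EllipticEisenstein

/-- The pair of periods `(1, τ)`. -/
def periods (τ : UpperHalfPlane) : PeriodPair where
  ω₁ := 1
  ω₂ := (τ : ℂ)
  indep := by
    rw [LinearIndependent.pair_iff]
    intro s t h
    have him := congrArg Complex.im h
    have hre := congrArg Complex.re h
    have ht : t = 0 := by
      simpa [τ.im_ne_zero] using him
    subst ht
    exact ⟨by simpa using hre, rfl⟩

/-- The lattice `L_τ = ℤ + ℤ τ`. -/
abbrev lattice (τ : UpperHalfPlane) : Submodule ℤ ℂ := (periods τ).lattice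

/-- The complex elliptic curve `E_τ = ℂ / L_τ`, as an abelian group. -/
abbrev Curve (τ : UpperHalfPlane) : Type := ℂ ⧸ lattice τ

/-- The point `P_α` of `E_τ` below `α`. -/
abbrev point (τ : UpperHalfPlane) (α : ℂ) : Curve τ := Submodule.Quotient.mk α

/-- `Dt`, a divisor `∑ m_α (α)` on `ℂ`, is a lift of the divisor `D` on `E_τ`:
`∑ m_α (P_α) = D`. -/
def IsLift (τ : UpperHalfPlane) (Dt : ℂ →₀ ℤ) (D : Curve τ →₀ ℤ) : Prop :=
  Finsupp.mapDomain (point τ) Dt = D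

/-- A principal lift: a lift with `∑ m_α = 0` and `∑ m_α α = 0`, both sums in `ℂ`. -/
structure IsPrincipalLift (τ : UpperHalfPlane) (Dt : ℂ →₀ ℤ) (D : Curve τ →₀ ℤ) : Prop where
  isLift : IsLift τ Dt D
  degree_eq_zero : (Dt.sum fun _ m => m) = 0
  sum_eq_zero : (Dt.sum fun α m => (m : ℂ) * α) = 0

/-- Elliptic functions for `L_τ`: meromorphic on `ℂ` and `L_τ`-periodic. As functions `ℂ → ℂ` they
are in normal form, i.e. removable singularities are removed and the value at poles is `0`. -/
structure IsElliptic (τ : UpperHalfPlane) (f : ℂ → ℂ) : Prop where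
  meromorphicNFOn : MeromorphicNFOn f Set.univ
  periodic : ∀ ω ∈ lattice τ, ∀ z, f (z + ω) = f z

/-- `Div(f) = D`. Orders are finite, so `f` is not identically zero. -/
def HasDivisor (τ : UpperHalfPlane) (f : ℂ → ℂ) (D : Curve τ →₀ ℤ) : Prop :=
  ∀ z, meromorphicOrderAt f z = ((D (point τ z) : ℤ) : WithTop ℤ)

/-- Principal divisors on `E_τ`: the divisors of nonzero elliptic functions. -/
def IsPrincipal (τ : UpperHalfPlane) (D : Curve τ →₀ ℤ) : Prop :=
  ∃ f, IsElliptic τ f ∧ HasDivisor τ f D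

/-- `f` is the elliptic function `f_D`: its divisor is `D`, and `f = z ^ m₀ (1 + O(z))` near `0`,
where `m₀` is the multiplicity in `D` of the origin of `E_τ`. -/
structure IsNormalizedFunction (τ : UpperHalfPlane) (D : Curve τ →₀ ℤ) (f : ℂ → ℂ) : Prop where
  isElliptic : IsElliptic τ f
  hasDivisor : HasDivisor τ f D
  normalized : (fun z => f z / z ^ D 0 - 1) =O[𝓝[≠] (0 : ℂ)] (fun z => z)

/-- The Weierstrass zeta function of `L_τ`. -/
def weierstrassZeta (τ : UpperHalfPlane) (z : ℂ) : ℂ :=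
  1 / z + ∑' ω : {ω : lattice τ // ω ≠ 0},
    (1 / (z - (ω : ℂ)) + 1 / (ω : ℂ) + z / (ω : ℂ) ^ 2)

/-- The series `∑' 1 / ((α + ω) ^ j |α + ω| ^ (2 s))` over `ω ∈ L_τ` with `ω ≠ -α`, which converges
absolutely for `Re s > 1 - j / 2`. -/
def eisensteinSeries (τ : UpperHalfPlane) (j : ℕ) (α s : ℂ) : ℂ :=
  ∑' ω : {ω : lattice τ // α + (ω : ℂ) ≠ 0},
    1 / ((α + (ω : ℂ)) ^ j * ((‖α + (ω : ℂ)‖ : ℝ) : ℂ) ^ (2 * s))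

/-- `e` is the value at `s` of the analytic continuation of `w ↦ eisensteinSeries τ j α w`, to a half
plane containing `s`, from the half plane of absolute convergence. -/
def IsContinuedValue (τ : UpperHalfPlane) (j : ℕ) (α s e : ℂ) : Prop :=
  ∃ (σ : ℝ) (F : ℂ → ℂ), σ < s.re ∧ DifferentiableOn ℂ F {w | σ < w.re} ∧
    (∀ w : ℂ, σ < w.re → 1 - (j : ℝ) / 2 < w.re → F w = eisensteinSeries τ j α w) ∧ F s = e

/-- The continued value is unique. -/
theorem IsContinuedValue.unique {τ : UpperHalfPlane} {j : ℕ} {α s e e' : ℂ}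
    (h : IsContinuedValue τ j α s e) (h' : IsContinuedValue τ j α s e') : e = e' := by
  obtain ⟨σ, F, hσ, hF, hFE, rfl⟩ := h
  obtain ⟨σ', F', hσ', hF', hFE', rfl⟩ := h'
  set μ : ℝ := max σ σ' with hμ
  set ν : ℝ := max μ (1 - (j : ℝ) / 2) with hν
  have hopen (c : ℝ) : IsOpen {w : ℂ | c < w.re} := isOpen_lt continuous_const Complex.continuous_re
  have hpre : IsPreconnected {w : ℂ | μ < w.re} := (convex_halfSpace_re_gt μ).isPreconnected
  have hA : AnalyticOnNhd ℂ F {w | μ < w.re} :=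
    DifferentiableOn.analyticOnNhd
      (hF.mono fun w (hw : μ < w.re) => lt_of_le_of_lt (le_max_left σ σ') hw) (hopen μ)
  have hA' : AnalyticOnNhd ℂ F' {w | μ < w.re} :=
    DifferentiableOn.analyticOnNhd
      (hF'.mono fun w (hw : μ < w.re) => lt_of_le_of_lt (le_max_right σ σ') hw) (hopen μ)
  have hz : ((ν + 1 : ℝ) : ℂ) ∈ {w : ℂ | μ < w.re} := by
    have : μ ≤ ν := le_max_left _ _
    simp only [Set.mem_ofPred_eq, Complex.ofReal_re]
    linarith
  have hev : F =ᶠ[𝓝 ((ν + 1 : ℝ) : ℂ)] F' := by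
    filter_upwards [(hopen ν).mem_nhds (by simp : ((ν + 1 : ℝ) : ℂ) ∈ {w : ℂ | ν < w.re})]
      with w hw
    have h1 : μ < w.re := lt_of_le_of_lt (le_max_left _ _) hw
    have h2 : 1 - (j : ℝ) / 2 < w.re := lt_of_le_of_lt (le_max_right _ _) hw
    rw [hFE w (lt_of_le_of_lt (le_max_left _ _) h1) h2,
      hFE' w (lt_of_le_of_lt (le_max_right _ _) h1) h2]
  exact hA.eqOn_of_preconnected_of_eventuallyEq hA' hpre hz hev (max_lt hσ hσ')

open Classical in
/-- The Eisenstein series `E_j(τ, α; s)`, by analytic continuation in `s`. -/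
def eisenstein (τ : UpperHalfPlane) (j : ℕ) (α s : ℂ) : ℂ :=
  if h : ∃ e, IsContinuedValue τ j α s e then h.choose else 0

/-- `∑ m_α E_j(τ, α; s)` for a divisor `∑ m_α (α)` on `ℂ`. When this is a lift of a divisor `D` on
`E_τ`, this is `E_j(τ, D; s)`, and it does not depend on the lift. -/
def eisensteinDivisor (τ : UpperHalfPlane) (j : ℕ) (Dt : ℂ →₀ ℤ) (s : ℂ) : ℂ :=
  Dt.sum fun α m => (m : ℂ) * eisenstein τ j α s

/-- The complement in `ℂ` of the points `α + ω`, with `α` in the support of `Dt` and `ω ∈ L_τ`. -/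
def regularSet (τ : UpperHalfPlane) (Dt : ℂ →₀ ℤ) : Set ℂ :=
  {z | ∀ α ∈ Dt.support, z - α ∉ lattice τ}

/-- The term `∑_α m_α / (z - α - ω)` of the lattice sum. -/
def latticeTerm (Dt : ℂ →₀ ℤ) (ω z : ℂ) : ℂ :=
  Dt.sum fun α m => (m : ℂ) / (z - α - ω)

end EllipticEisenstein

end

/-! Let R(u) = ∏ (u - α)^(m_α) and h = ½ ∑ m_α α². The two vanishing moments give log R(u) = -h/u² +
O(|u|⁻³) at infinity, so ∏_ω R(z - ω) exp(h/ω²) converges (with factor R(z) at ω = 0), and its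
logarithmic derivative is the lattice series. The same moments allow 1/ω + (z - α)/ω² to be added to
each 1/(z - α - ω): this makes the terms O(|ω|⁻³) and the sum ∑ m_α ζ(z - α).

The factors exp(h/ω²) do not involve z, so translation by a period e multiplies the product by ∏_ω
R(z + e - ω)/R(z - ω). This converges absolutely, and along each line of lattice points parallel to
e it telescopes to a quotient of limits of R at infinity, which is 1. Thus the product is elliptic
(`latticeProd_add_of_basis`), and quasi-periods are not needed. Its divisor is D, so by Liouville
(`exists_eventually_eq_const_mul`) f_D is a constant multiple of it.

Near 0 every pole other than 0 is expanded in a geometric series and the double sum is exchanged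
(`hasSum_laurent`). The coefficient of z^(j-1) is -∑_ω ∑_α m_α (α + ω)^(-j), with α summed first,
whereas E_j(τ, α) continues the series of one α at a time. That series is continued to Re s > -1/4
by subtracting from each term its symmetrized average over a cell. The averages add up to an
integral over the plane, which a rotation by π/j shows to be zero; the symmetrization cancels the
first-order Taylor terms and leaves O(|v|^(-5/2)). The same Taylor estimate and the vanishing
moments make the series with α summed first converge and be holomorphic there. The two continuations
agree for large Re s, hence at s = 0 (`summable_and_eisensteinDivisor_eq`). -/

noncomputable section

/-! ### Summability over the lattice -/

namespace EllipticEisenstein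
open Filter

theorem finite_norm_add_le (τ : UpperHalfPlane) (α : ℂ) (R : ℝ) :
    {ω : lattice τ | ‖α + (ω : ℂ)‖ ≤ R}.Finite := by
  refine (isCompact_iff_finite.mp
    (isCompact_closedBall (0 : lattice τ) (R + ‖α‖))).subset fun ω hω => ?_
  have h : ‖(ω : ℂ)‖ ≤ ‖α + (ω : ℂ)‖ + ‖α‖ := by
    simpa using norm_sub_le (α + (ω : ℂ)) α
  simp only [Set.mem_ofPred_eq] at hω
  simp only [Metric.mem_closedBall, dist_zero_right]
  change ‖(ω : ℂ)‖ ≤ _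
  linarith

theorem eventually_lt_norm_add (τ : UpperHalfPlane) (α : ℂ) (R : ℝ) :
    ∀ᶠ ω : lattice τ in cofinite, R < ‖α + (ω : ℂ)‖ := by
  have := finite_norm_add_le τ α R
  rw [eventually_cofinite]
  simpa using this

theorem eventually_lt_norm (τ : UpperHalfPlane) (R : ℝ) :
    ∀ᶠ ω : lattice τ in cofinite, R < ‖(ω : ℂ)‖ := by
  simpa using eventually_lt_norm_add τ 0 R

theorem summable_norm_add_rpow (τ : UpperHalfPlane) (α : ℂ) {r : ℝ} (hr : r < -2) :
    Summable fun ω : lattice τ => ‖α + (ω : ℂ)‖ ^ r := by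
  have := ZLattice.summable_norm_sub_rpow (lattice τ) r (by simpa using hr) (-α)
  refine this.congr fun ω => ?_
  rw [sub_neg_eq_add, add_comm]

theorem summable_norm_rpow (τ : UpperHalfPlane) {r : ℝ} (hr : r < -2) :
    Summable fun ω : lattice τ => ‖(ω : ℂ)‖ ^ r := by
  simpa using summable_norm_add_rpow τ 0 hr

theorem summable_div_norm_pow_three (τ : UpperHalfPlane) (C : ℝ) :
    Summable fun ω : lattice τ => C / ‖(ω : ℂ)‖ ^ 3 := by
  refine ((summable_norm_rpow τ (r := -3) (by norm_num)).mul_left C).congr fun ω => ?_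
  rw [div_eq_mul_inv, Real.rpow_neg (norm_nonneg _)]
  norm_cast

end EllipticEisenstein

/-! ### The lattice sum of a principal lift and the zeta function -/

namespace EllipticEisenstein
open Filter

theorem sum_mul_affine_eq_zero {Dt : ℂ →₀ ℤ} (h0 : (Dt.sum fun _ m => m) = 0)
    (h1 : (Dt.sum fun α m => (m : ℂ) * α) = 0) (a b : ℂ) :
    ∑ α ∈ Dt.support, (Dt α : ℂ) * (a + b * α) = 0 := by
  have h0' : ∑ α ∈ Dt.support, (Dt α : ℂ) = 0 := by
    have := congrArg (Int.cast : ℤ → ℂ) h0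
    simpa [Finsupp.sum] using this
  have h1' : ∑ α ∈ Dt.support, (Dt α : ℂ) * α = 0 := h1
  calc ∑ α ∈ Dt.support, (Dt α : ℂ) * (a + b * α)
      = a * ∑ α ∈ Dt.support, (Dt α : ℂ) + b * ∑ α ∈ Dt.support, (Dt α : ℂ) * α := by
        rw [Finset.mul_sum, Finset.mul_sum, ← Finset.sum_add_distrib]
        exact Finset.sum_congr rfl fun _ _ => by ring
    _ = 0 := by rw [h0', h1']; ring

theorem norm_zetaTerm_le {u ω : ℂ} (hω : ω ≠ 0) (h : 2 * ‖u‖ ≤ ‖ω‖) :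
    ‖1 / (u - ω) + 1 / ω + u / ω ^ 2‖ ≤ 2 * ‖u‖ ^ 2 / ‖ω‖ ^ 3 := by
  have hpos : 0 < ‖ω‖ := norm_pos_iff.mpr hω
  have h2 : ‖ω‖ / 2 ≤ ‖u - ω‖ := by
    have := norm_sub_norm_le ω u
    rw [norm_sub_rev] at this
    linarith
  have hne : u - ω ≠ 0 := norm_pos_iff.mp (by linarith)
  have : 1 / (u - ω) + 1 / ω + u / ω ^ 2 = u ^ 2 / (ω ^ 2 * (u - ω)) := by
    field_simp
    ring
  rw [this, norm_div, norm_mul, norm_pow, norm_pow,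
    div_le_div_iff₀ (mul_pos (by positivity) (by linarith)) (by positivity)]
  nlinarith [mul_nonneg (sq_nonneg ‖u‖) (sq_nonneg ‖ω‖),
    mul_le_mul_of_nonneg_left h2 (mul_nonneg (sq_nonneg ‖u‖) (sq_nonneg ‖ω‖))]

/-- The added terms are affine in α, so the vanishing moments kill their weighted sum. -/
theorem latticeTerm_eq_sum_zetaTerm {Dt : ℂ →₀ ℤ} (h0 : (Dt.sum fun _ m => m) = 0)
    (h1 : (Dt.sum fun α m => (m : ℂ) * α) = 0) (ω z : ℂ) :
    latticeTerm Dt ω z = ∑ α ∈ Dt.support,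
      (Dt α : ℂ) * (1 / (z - α - ω) + 1 / ω + (z - α) / ω ^ 2) := by
  have := sum_mul_affine_eq_zero h0 h1 (1 / ω + z / ω ^ 2) (-1 / ω ^ 2)
  rw [← add_zero (latticeTerm Dt ω z), ← this, latticeTerm, Finsupp.sum,
    ← Finset.sum_add_distrib]
  exact Finset.sum_congr rfl fun _ _ => by ring

theorem exists_norm_latticeTerm_le {Dt : ℂ →₀ ℤ} (h0 : (Dt.sum fun _ m => m) = 0)
    (h1 : (Dt.sum fun α m => (m : ℂ) * α) = 0) (B : ℝ) :
    ∃ C R : ℝ, ∀ z ω : ℂ, ‖z‖ ≤ B → R ≤ ‖ω‖ → ‖latticeTerm Dt ω z‖ ≤ C / ‖ω‖ ^ 3 := by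
  set M : ℝ := ∑ α ∈ Dt.support, ‖α‖ with hM
  -- The radius forces 2‖z - α‖ ≤ ‖ω‖ for every α in the support; the final 1 keeps ω away from 0.
  refine ⟨∑ α ∈ Dt.support, ‖(Dt α : ℂ)‖ * (2 * (B + M) ^ 2), 2 * (|B| + M) + 1,
    fun z ω hz hω => ?_⟩
  have hM0 : 0 ≤ M := Finset.sum_nonneg fun _ _ => norm_nonneg _
  have hpos : 0 < ‖ω‖ := by have := abs_nonneg B; linarith
  rw [latticeTerm_eq_sum_zetaTerm h0 h1, Finset.sum_div]
  refine (norm_sum_le _ _).trans (Finset.sum_le_sum fun α hα => ?_)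
  have hαM : ‖α‖ ≤ M := Finset.single_le_sum (f := fun α : ℂ => ‖α‖) (fun _ _ => norm_nonneg _) hα
  have hu : ‖z - α‖ ≤ B + M := (norm_sub_le _ _).trans (add_le_add hz hαM)
  rw [norm_mul, mul_div_assoc]
  refine mul_le_mul_of_nonneg_left ((norm_zetaTerm_le (norm_pos_iff.mp hpos) ?_).trans ?_)
    (norm_nonneg _)
  · have := le_abs_self B
    linarith
  · gcongr

theorem summable_zetaTerm (τ : UpperHalfPlane) (u : ℂ) :
    Summable fun ω : lattice τ => 1 / (u - (ω : ℂ)) + 1 / (ω : ℂ) + u / (ω : ℂ) ^ 2 := by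
  refine Summable.of_norm_bounded_eventually (summable_div_norm_pow_three τ (2 * ‖u‖ ^ 2)) ?_
  filter_upwards [eventually_lt_norm τ (2 * ‖u‖)] with ω hω
  have : 0 < ‖(ω : ℂ)‖ := lt_of_le_of_lt (by positivity) hω
  exact norm_zetaTerm_le (norm_pos_iff.mp this) hω.le

theorem hasSum_weierstrassZeta (τ : UpperHalfPlane) (u : ℂ) :
    HasSum (fun ω : lattice τ => 1 / (u - (ω : ℂ)) + 1 / (ω : ℂ) + u / (ω : ℂ) ^ 2)
      (weierstrassZeta τ u) := by
  classical
  have h := (summable_zetaTerm τ u).hasSum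
  convert h using 1
  rw [(summable_zetaTerm τ u).tsum_eq_add_tsum_ite 0, weierstrassZeta]
  congr 1
  -- The summand at ω = 0 is 1/u, because 1/0 = 0.
  · simp
  · refine (tsum_subtype {ω : lattice τ | ω ≠ 0}
      (fun ω : lattice τ => 1 / (u - (ω : ℂ)) + 1 / (ω : ℂ) + u / (ω : ℂ) ^ 2)).trans
      (tsum_congr fun ω => ?_)
    by_cases hω : ω = 0 <;> simp [hω]

/-- No condition on z is needed: at a pole, both sides read the singular term as 1/0 = 0. -/
theorem hasSum_latticeTerm_zeta (τ : UpperHalfPlane) {Dt : ℂ →₀ ℤ}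
    (h0 : (Dt.sum fun _ m => m) = 0) (h1 : (Dt.sum fun α m => (m : ℂ) * α) = 0) (z : ℂ) :
    HasSum (fun ω : lattice τ => latticeTerm Dt (ω : ℂ) z)
      (Dt.sum fun α m => (m : ℂ) * weierstrassZeta τ (z - α)) := by
  simp_rw [latticeTerm_eq_sum_zetaTerm h0 h1]
  exact hasSum_sum fun α _ => (hasSum_weierstrassZeta τ (z - α)).mul_left _

theorem summable_norm_latticeTerm (τ : UpperHalfPlane) {Dt : ℂ →₀ ℤ}
    (h0 : (Dt.sum fun _ m => m) = 0) (h1 : (Dt.sum fun α m => (m : ℂ) * α) = 0) (z : ℂ) :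
    Summable fun ω : lattice τ => ‖latticeTerm Dt (ω : ℂ) z‖ :=
  (hasSum_latticeTerm_zeta τ h0 h1 z).summable.norm

theorem isOpen_regularSet (τ : UpperHalfPlane) (Dt : ℂ →₀ ℤ) : IsOpen (regularSet τ Dt) := by
  have : regularSet τ Dt = ⋂ α ∈ Dt.support, (fun z : ℂ => z - α) ⁻¹' (lattice τ : Set ℂ)ᶜ := by
    ext z
    simp [regularSet]
  rw [this]
  exact isOpen_biInter_finset fun α _ =>
    (periods τ).isClosed_lattice.isOpen_compl.preimage (by fun_prop)

theorem hasSumLocallyUniformlyOn_latticeTerm (τ : UpperHalfPlane) {Dt : ℂ →₀ ℤ}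
    (h0 : (Dt.sum fun _ m => m) = 0) (h1 : (Dt.sum fun α m => (m : ℂ) * α) = 0) :
    HasSumLocallyUniformlyOn (fun (ω : lattice τ) (z : ℂ) => latticeTerm Dt (ω : ℂ) z)
      (fun z => Dt.sum fun α m => (m : ℂ) * weierstrassZeta τ (z - α)) (regularSet τ Dt) := by
  refine hasSumLocallyUniformlyOn_of_forall_compact (isOpen_regularSet τ Dt) fun K hK hKc => ?_
  obtain ⟨B, hB⟩ := hKc.isBounded.exists_norm_le
  obtain ⟨C, R, hCR⟩ := exists_norm_latticeTerm_le h0 h1 B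
  rw [hasSumUniformlyOn_iff_tendstoUniformlyOn]
  have : TendstoUniformlyOn
      (fun t : Finset (lattice τ) => fun z => ∑ ω ∈ t, latticeTerm Dt (ω : ℂ) z)
      (fun z => ∑' ω : lattice τ, latticeTerm Dt (ω : ℂ) z) atTop K := by
    refine tendstoUniformlyOn_tsum_of_cofinite_eventually (summable_div_norm_pow_three τ C) ?_
    filter_upwards [eventually_lt_norm τ R] with ω hω z hz
    exact hCR z ω (hB z hz) hω.le
  refine this.congr_right fun z _ => ?_
  exact (hasSum_latticeTerm_zeta τ h0 h1 z).tsum_eq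

end EllipticEisenstein

/-! ### Local factorization of the lattice product -/

namespace EllipticEisenstein
open Filter

/-- Half of the second moment `∑ m_α α ^ 2` of a divisor on `ℂ`. -/
def halfSecondMoment (Dt : ℂ →₀ ℤ) : ℂ := (∑ α ∈ Dt.support, (Dt α : ℂ) * α ^ 2) / 2

/-- The rational function `∏ (z - α) ^ m_α`, translated by `ω` and normalized so that the product
over `ω` converges. -/
def latticeFactor (Dt : ℂ →₀ ℤ) (ω z : ℂ) : ℂ :=
  (∏ α ∈ Dt.support, (z - ω - α) ^ Dt α) * Complex.exp (halfSecondMoment Dt / ω ^ 2)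

/-- The logarithm of `latticeFactor` for large `ω`. -/
def latticeLog (Dt : ℂ →₀ ℤ) (ω z : ℂ) : ℂ :=
  (∑ α ∈ Dt.support, (Dt α : ℂ) * Complex.log (1 + (α - z) / ω)) + halfSecondMoment Dt / ω ^ 2

/-- A radius beyond which lattice points are far from `‖z‖ ≤ B` and from the support. -/
def tailRadius (Dt : ℂ →₀ ℤ) (B : ℝ) : ℝ := 2 * (|B| + ∑ α ∈ Dt.support, ‖α‖) + 1

theorem tailRadius_pos (Dt : ℂ →₀ ℤ) (B : ℝ) : 0 < tailRadius Dt B := by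
  unfold tailRadius
  positivity

theorem two_mul_norm_sub_lt {Dt : ℂ →₀ ℤ} {B : ℝ} {α z ω : ℂ} (hα : α ∈ Dt.support)
    (hz : ‖z‖ ≤ B) (hω : tailRadius Dt B ≤ ‖ω‖) : 2 * ‖α - z‖ < ‖ω‖ := by
  have hαM : ‖α‖ ≤ ∑ α ∈ Dt.support, ‖α‖ :=
    Finset.single_le_sum (f := fun α : ℂ => ‖α‖) (fun _ _ => norm_nonneg _) hα
  have h1 := norm_sub_le α z
  have h2 := le_abs_self B
  unfold tailRadius at hω
  linarith

theorem norm_div_lt_half {Dt : ℂ →₀ ℤ} {B : ℝ} {α z ω : ℂ} (hα : α ∈ Dt.support)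
    (hz : ‖z‖ ≤ B) (hω : tailRadius Dt B ≤ ‖ω‖) : ‖(α - z) / ω‖ < 1 / 2 := by
  have hpos := (tailRadius_pos Dt B).trans_le hω
  rw [norm_div, div_lt_iff₀ hpos]
  linarith [two_mul_norm_sub_lt hα hz hω]

theorem one_add_div_mem_slitPlane {Dt : ℂ →₀ ℤ} {B : ℝ} {α z ω : ℂ} (hα : α ∈ Dt.support)
    (hz : ‖z‖ ≤ B) (hω : tailRadius Dt B ≤ ‖ω‖) : 1 + (α - z) / ω ∈ Complex.slitPlane :=
  Complex.mem_slitPlane_of_norm_lt_one ((norm_div_lt_half hα hz hω).trans (by norm_num))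

theorem prod_zpow_eq_zpow_sum {ι : Type*} {a : ℂ} (ha : a ≠ 0) (s : Finset ι) (m : ι → ℤ) :
    ∏ i ∈ s, a ^ m i = a ^ ∑ i ∈ s, m i := by
  classical
  induction s using Finset.induction_on with
  | empty => simp
  | insert i s hi ih => rw [Finset.prod_insert hi, Finset.sum_insert hi, zpow_add₀ ha, ih]

/-- Each z - ω - α is (-ω)(1 + (α - z)/ω), and the powers of -ω multiply to 1 because the degree is
zero. -/
theorem exp_latticeLog {Dt : ℂ →₀ ℤ} (h0 : (Dt.sum fun _ m => m) = 0) {B : ℝ} {z ω : ℂ}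
    (hz : ‖z‖ ≤ B) (hω : tailRadius Dt B ≤ ‖ω‖) :
    Complex.exp (latticeLog Dt ω z) = latticeFactor Dt ω z := by
  have hω0 : ω ≠ 0 := norm_pos_iff.mp ((tailRadius_pos Dt B).trans_le hω)
  rw [latticeLog, latticeFactor, Complex.exp_add, Complex.exp_sum]
  congr 1
  have h : ∏ α ∈ Dt.support, (-ω) ^ Dt α = 1 := by
    have : ∑ α ∈ Dt.support, Dt α = 0 := h0
    rw [prod_zpow_eq_zpow_sum (neg_ne_zero.mpr hω0), this, zpow_zero]
  calc ∏ α ∈ Dt.support, Complex.exp ((Dt α : ℂ) * Complex.log (1 + (α - z) / ω))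
      = (∏ α ∈ Dt.support, (-ω) ^ Dt α) * ∏ α ∈ Dt.support, (1 + (α - z) / ω) ^ Dt α := by
        rw [h, one_mul]
        refine Finset.prod_congr rfl fun α hα => ?_
        rw [Complex.exp_int_mul,
          Complex.exp_log (Complex.slitPlane_ne_zero (one_add_div_mem_slitPlane hα hz hω))]
    _ = _ := by
        rw [← Finset.prod_mul_distrib]
        refine Finset.prod_congr rfl fun α _ => ?_
        rw [← mul_zpow]
        congr 1
        field_simp
        ring

theorem norm_log_one_add_sub_le {x : ℂ} (hx : ‖x‖ ≤ 1 / 2) :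
    ‖Complex.log (1 + x) - x + x ^ 2 / 2‖ ≤ ‖x‖ ^ 3 := by
  have h := Complex.norm_log_sub_logTaylor_le 2 (z := x) (by linarith)
  have hT : Complex.logTaylor (2 + 1) x = x - x ^ 2 / 2 := by
    rw [Complex.logTaylor_succ, Complex.logTaylor_succ, Complex.logTaylor_succ,
      Complex.logTaylor_zero]
    norm_num
    ring
  rw [hT, ← sub_add] at h
  refine h.trans ?_
  have h2 : (1 - ‖x‖)⁻¹ ≤ 2 := by
    rw [inv_le_comm₀ (by linarith) two_pos]
    linarith
  have h3 : (0 : ℝ) ≤ ‖x‖ ^ 3 := by positivity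
  norm_num
  nlinarith [mul_le_mul_of_nonneg_left h2 h3]

/-- Expand log(1 + x) = x - x²/2 + O(|x|³) at x = (α - z)/ω. The moments kill everything affine in
α, and the remaining α²/ω² part is cancelled by `halfSecondMoment`. -/
theorem norm_latticeLog_le {Dt : ℂ →₀ ℤ} (h0 : (Dt.sum fun _ m => m) = 0)
    (h1 : (Dt.sum fun α m => (m : ℂ) * α) = 0) {B : ℝ} {z ω : ℂ}
    (hz : ‖z‖ ≤ B) (hω : tailRadius Dt B ≤ ‖ω‖) :
    ‖latticeLog Dt ω z‖ ≤
      (∑ α ∈ Dt.support, ‖(Dt α : ℂ)‖ * (‖α‖ + B) ^ 3) / ‖ω‖ ^ 3 := by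
  have hω0 : ω ≠ 0 := norm_pos_iff.mp ((tailRadius_pos Dt B).trans_le hω)
  -- The part of -x + x²/2 that is affine in α, for x = (α - z)/ω.
  have hlin := sum_mul_affine_eq_zero h0 h1 (z / ω + z ^ 2 / (2 * ω ^ 2)) (-1 / ω - z / ω ^ 2)
  have hrw : latticeLog Dt ω z = ∑ α ∈ Dt.support, (Dt α : ℂ) *
      (Complex.log (1 + (α - z) / ω) - (α - z) / ω + ((α - z) / ω) ^ 2 / 2) := by
    rw [latticeLog, halfSecondMoment, ← sub_eq_zero, add_sub_assoc, Finset.sum_div,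
      Finset.sum_div, ← Finset.sum_sub_distrib, ← Finset.sum_add_distrib, ← neg_eq_zero, ← hlin,
      ← Finset.sum_neg_distrib]
    refine Finset.sum_congr rfl fun α _ => ?_
    field_simp
    ring
  rw [hrw, Finset.sum_div]
  refine (norm_sum_le _ _).trans (Finset.sum_le_sum fun α hα => ?_)
  rw [norm_mul, mul_div_assoc]
  refine mul_le_mul_of_nonneg_left
    ((norm_log_one_add_sub_le (norm_div_lt_half hα hz hω).le).trans ?_) (norm_nonneg _)
  rw [norm_div, div_pow]
  gcongr
  exact (norm_sub_le _ _).trans (by gcongr)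

theorem hasDerivAt_latticeLog {Dt : ℂ →₀ ℤ} {B : ℝ} {z ω : ℂ}
    (hz : ‖z‖ ≤ B) (hω : tailRadius Dt B ≤ ‖ω‖) :
    HasDerivAt (latticeLog Dt ω) (latticeTerm Dt ω z) z := by
  have hω0 : ω ≠ 0 := norm_pos_iff.mp ((tailRadius_pos Dt B).trans_le hω)
  refine HasDerivAt.add_const _ (HasDerivAt.fun_sum fun α hα => ?_)
  have hs := one_add_div_mem_slitPlane hα hz hω
  have hlin : HasDerivAt (fun w : ℂ => 1 + (α - w) / ω) (-1 / ω) z := by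
    simpa using (((hasDerivAt_id z).const_sub α).div_const ω).const_add 1
  have hne : z - α - ω ≠ 0 := by
    intro h
    apply Complex.slitPlane_ne_zero hs
    have : α - z = -ω := by linear_combination -h
    rw [this, neg_div, div_self hω0, add_neg_cancel]
  have hne' : ω + (α - z) ≠ 0 := fun h => hne (by linear_combination -h)
  have hq : 1 + (α - z) / ω = (ω + (α - z)) / ω := by field_simp
  refine ((hlin.clog hs).const_mul (Dt α : ℂ)).congr_deriv ?_
  rw [hq, div_div_div_cancel_right₀ hω0, mul_div_assoc', div_eq_div_iff hne' hne]
  ring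

/-- On a disc, the lattice product is a finite product times the exponential of a holomorphic
function, whose derivative is the tail of the lattice sum. -/
theorem exists_local_factorization (τ : UpperHalfPlane) {Dt : ℂ →₀ ℤ}
    (h0 : (Dt.sum fun _ m => m) = 0) (h1 : (Dt.sum fun α m => (m : ℂ) * α) = 0) (B : ℝ) :
    ∃ (F : Finset (lattice τ)) (V : ℂ → ℂ),
      (∀ ω : lattice τ, ω ∉ F → tailRadius Dt B ≤ ‖(ω : ℂ)‖) ∧
      DifferentiableOn ℂ V (Metric.ball 0 B) ∧
      ∀ z ∈ Metric.ball (0 : ℂ) B,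
        HasProd (fun ω : lattice τ => latticeFactor Dt (ω : ℂ) z)
          ((∏ ω ∈ F, latticeFactor Dt (ω : ℂ) z) * Complex.exp (V z)) ∧
        deriv V z + ∑ ω ∈ F, latticeTerm Dt (ω : ℂ) z =
          ∑' ω : lattice τ, latticeTerm Dt (ω : ℂ) z := by
  classical
  set F : Finset (lattice τ) := (finite_norm_add_le τ 0 (tailRadius Dt B)).toFinset with hF
  have hFm : ∀ ω : lattice τ, ω ∉ F → tailRadius Dt B ≤ ‖(ω : ℂ)‖ := by
    intro ω hω
    have : ¬ ‖(ω : ℂ)‖ ≤ tailRadius Dt B := by simpa [hF] using hω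
    exact (not_le.mp this).le
  -- Logarithms are taken only outside F, where 1 + (α - z)/ω stays in the slit plane.
  set v : lattice τ → ℂ → ℂ := fun ω z => if ω ∈ F then 0 else latticeLog Dt (ω : ℂ) z with hv
  set C := ∑ α ∈ Dt.support, ‖(Dt α : ℂ)‖ * (‖α‖ + |B|) ^ 3 with hC
  have hb : ∀ (ω : lattice τ), ∀ z ∈ Metric.ball (0 : ℂ) B, ‖v ω z‖ ≤ C / ‖(ω : ℂ)‖ ^ 3 := by
    intro ω z hz
    have hzB : ‖z‖ ≤ B := (mem_ball_zero_iff.mp hz).le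
    have hB : |B| = B := abs_of_nonneg ((norm_nonneg z).trans hzB)
    by_cases hω : ω ∈ F
    · simp only [hv, hω, if_true, norm_zero]
      positivity
    · simp only [hv, hω, if_false]
      have := norm_latticeLog_le h0 h1 hzB (hFm ω hω)
      rwa [hC, hB]
  have hsum := summable_div_norm_pow_three τ C
  have hd : ∀ ω : lattice τ, ∀ z ∈ Metric.ball (0 : ℂ) B,
      HasDerivAt (v ω) (if ω ∈ F then 0 else latticeTerm Dt (ω : ℂ) z) z := by
    intro ω z hz
    by_cases hω : ω ∈ F
    · simp only [hv, hω, if_true]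
      exact hasDerivAt_const _ _
    · simp only [hv, hω, if_false]
      exact hasDerivAt_latticeLog (mem_ball_zero_iff.mp hz).le (hFm ω hω)
  have hdv : ∀ ω : lattice τ, DifferentiableOn ℂ (v ω) (Metric.ball 0 B) :=
    fun ω z hz => (hd ω z hz).differentiableAt.differentiableWithinAt
  refine ⟨F, fun z => ∑' ω, v ω z, hFm,
    Complex.differentiableOn_tsum_of_summable_norm hsum hdv Metric.isOpen_ball hb, fun z hz => ⟨?_, ?_⟩⟩
  · have hS : HasSum (fun ω => v ω z) (∑' ω, v ω z) :=
      (Summable.of_norm_bounded hsum fun ω => hb ω z hz).hasSum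
    have h2 : HasProd (fun ω : lattice τ => if ω ∈ F then latticeFactor Dt (ω : ℂ) z else 1)
        (∏ ω ∈ F, latticeFactor Dt (ω : ℂ) z) := by
      have := hasProd_prod_of_ne_finset_one (s := F)
        (L := SummationFilter.unconditional _)
        (f := fun ω : lattice τ => if ω ∈ F then latticeFactor Dt (ω : ℂ) z else 1)
        (fun ω hω => by simp [hω])
      rwa [Finset.prod_congr rfl (fun ω hω => if_pos hω)] at this
    refine (h2.mul hS.cexp).congr_fun ?_
    intro ω
    by_cases hω : ω ∈ F
    · simp [hv, hω]
    · simp [hv, hω, exp_latticeLog h0 (mem_ball_zero_iff.mp hz).le (hFm ω hω)]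
  -- The locally uniform bound allows termwise differentiation of the tail.
  · have h3 := Complex.hasSum_deriv_of_summable_norm hsum hdv Metric.isOpen_ball hb hz
    simp_rw [(hd _ z hz).deriv] at h3
    have h4 : HasSum (fun ω : lattice τ => if ω ∈ F then latticeTerm Dt (ω : ℂ) z else 0)
        (∑ ω ∈ F, latticeTerm Dt (ω : ℂ) z) := by
      have := hasSum_sum_of_ne_finset_zero (s := F)
        (L := SummationFilter.unconditional _)
        (f := fun ω : lattice τ => if ω ∈ F then latticeTerm Dt (ω : ℂ) z else 0)
        (fun ω hω => by simp [hω])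
      rwa [Finset.sum_congr rfl (fun ω hω => if_pos hω)] at this
    rw [← (h3.add h4).tsum_eq]
    refine tsum_congr fun ω => ?_
    by_cases hω : ω ∈ F <;> simp [hω]

end EllipticEisenstein

/-! ### Periodicity of the lattice product -/

namespace EllipticEisenstein
open Filter

/-- The rational function `∏ (u - α) ^ m_α` on `ℂ` with divisor `Dt`. -/
def rationalFun (Dt : ℂ →₀ ℤ) (u : ℂ) : ℂ := ∏ α ∈ Dt.support, (u - α) ^ Dt α

theorem latticeFactor_eq (Dt : ℂ →₀ ℤ) (ω z : ℂ) :
    latticeFactor Dt ω z =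
      rationalFun Dt (z - ω) * Complex.exp (halfSecondMoment Dt / ω ^ 2) := rfl

/-- Poles count too: a negative power of 0 is 0. -/
theorem rationalFun_ne_zero_iff {Dt : ℂ →₀ ℤ} {u : ℂ} :
    rationalFun Dt u ≠ 0 ↔ u ∉ Dt.support := by
  rw [rationalFun, Finset.prod_ne_zero_iff]
  constructor
  · intro h hu
    exact h u hu (by rw [sub_self, zero_zpow _ (Finsupp.mem_support_iff.mp hu)])
  · intro h α hα
    exact zpow_ne_zero _ (sub_ne_zero.mpr fun hu => h (hu ▸ hα))

theorem tendsto_rationalFun {Dt : ℂ →₀ ℤ} (h0 : (Dt.sum fun _ m => m) = 0) :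
    Tendsto (rationalFun Dt) (Bornology.cobounded ℂ) (𝓝 1) := by
  have h : Tendsto (fun u : ℂ => ∏ α ∈ Dt.support, (1 - α * u⁻¹) ^ Dt α)
      (Bornology.cobounded ℂ) (𝓝 (∏ α ∈ Dt.support, (1 - α * 0) ^ Dt α)) :=
    tendsto_finsetProd _ fun α _ =>
      (tendsto_const_nhds.sub (tendsto_const_nhds.mul tendsto_inv₀_cobounded)).zpow₀ _
        (Or.inl (by simp))
  simp only [mul_zero, sub_zero, one_zpow, Finset.prod_const_one] at h
  refine h.congr' ?_
  filter_upwards [Bornology.eventually_ne_cobounded (0 : ℂ)] with u hu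
  have h1 : ∏ α ∈ Dt.support, u ^ Dt α = 1 := by
    have : ∑ α ∈ Dt.support, Dt α = 0 := h0
    rw [prod_zpow_eq_zpow_sum hu, this, zpow_zero]
  rw [← one_mul (∏ α ∈ Dt.support, (1 - α * u⁻¹) ^ Dt α)]
  nth_rw 1 [← h1]
  rw [rationalFun, ← Finset.prod_mul_distrib]
  refine Finset.prod_congr rfl fun α _ => ?_
  rw [← mul_zpow]
  congr 1
  field_simp

/-- Multipliability is assumed, so the value may be computed along the intervals [-N, N), where the
product is q(N)/q(-N). -/
theorem hasProd_int_telescope {q : ℤ → ℂ} (hq : ∀ m, q m ≠ 0) (htop : Tendsto q atTop (𝓝 1))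
    (hbot : Tendsto q atBot (𝓝 1)) (hs : Multipliable fun m => q (m + 1) / q m) :
    HasProd (fun m => q (m + 1) / q m) 1 := by
  have htel : ∀ N : ℕ, ∏ m ∈ Finset.Ico (-(N : ℤ)) N, q (m + 1) / q m = q N / q (-N) := by
    intro N
    induction N with
    | zero => simp [div_self (hq 0)]
    | succ N ih =>
      have h1 : Finset.Ico (-((N + 1 : ℕ) : ℤ)) ((N + 1 : ℕ) : ℤ) =
          insert (-((N : ℤ) + 1)) (insert (N : ℤ) (Finset.Ico (-(N : ℤ)) N)) := by
        ext m
        simp only [Finset.mem_insert, Finset.mem_Ico]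
        push_cast
        omega
      rw [h1, Finset.prod_insert, Finset.prod_insert, ih]
      · have := hq N
        have := hq (-(N : ℤ))
        have := hq (-((N : ℤ) + 1))
        have h2 : -((N : ℤ) + 1) + 1 = -(N : ℤ) := by ring
        push_cast
        rw [h2]
        field_simp
      · simp
      · simp only [Finset.mem_insert, Finset.mem_Ico]
        omega
  have h1 : Tendsto (fun N : ℕ => ∏ m ∈ Finset.Ico (-(N : ℤ)) N, q (m + 1) / q m) atTop
      (𝓝 (∏' m, q (m + 1) / q m)) := by
    refine hs.hasProd.comp (tendsto_atTop_finset_of_monotone ?_ fun m => ⟨m.natAbs + 1, ?_⟩)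
    · intro M N hMN
      exact Finset.Ico_subset_Ico (by simpa using hMN) (by simpa using hMN)
    · simp only [Finset.mem_Ico]
      omega
  simp_rw [htel] at h1
  have h2 : Tendsto (fun N : ℕ => q N / q (-(N : ℤ))) atTop (𝓝 (1 / 1)) :=
    (htop.comp tendsto_natCast_atTop_atTop).div
      (hbot.comp (tendsto_neg_atTop_atBot.comp tendsto_natCast_atTop_atTop)) one_ne_zero
  rw [div_one] at h2
  rw [← tendsto_nhds_unique h1 h2]
  exact hs.hasProd

theorem summable_ratio_sub_one (τ : UpperHalfPlane) {Dt : ℂ →₀ ℤ}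
    (h0 : (Dt.sum fun _ m => m) = 0) (h1 : (Dt.sum fun α m => (m : ℂ) * α) = 0) (z w : ℂ) :
    Summable fun ω : lattice τ =>
      ‖rationalFun Dt (w - (ω : ℂ)) / rationalFun Dt (z - (ω : ℂ)) - 1‖ := by
  set B := max ‖z‖ ‖w‖ with hB
  set C := ∑ α ∈ Dt.support, ‖(Dt α : ℂ)‖ * (‖α‖ + B) ^ 3 with hC
  have hB0 : 0 ≤ B := (norm_nonneg z).trans (le_max_left _ _)
  have hC0 : 0 ≤ C := by positivity
  -- The two logarithms contribute 2C/‖ω‖³, and ‖exp x - 1‖ ≤ 2‖x‖ for ‖x‖ ≤ 1 doubles this.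
  have hs := (summable_div_norm_pow_three τ C).mul_left 4
  refine Summable.of_norm_bounded_eventually hs ?_
  have hsmall := hs.tendsto_cofinite_zero.eventually_lt_const (zero_lt_one' ℝ)
  filter_upwards [eventually_lt_norm τ (tailRadius Dt B), hsmall] with ω hω hω1
  rw [norm_norm]
  have e1 := exp_latticeLog h0 (le_max_left ‖z‖ ‖w‖) hω.le
  have e2 := exp_latticeLog h0 (le_max_right ‖z‖ ‖w‖) hω.le
  have b1 := norm_latticeLog_le h0 h1 (le_max_left ‖z‖ ‖w‖) hω.le
  have b2 := norm_latticeLog_le h0 h1 (le_max_right ‖z‖ ‖w‖) hω.le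
  rw [← hB, ← hC] at b1 b2
  have hr : rationalFun Dt (w - (ω : ℂ)) / rationalFun Dt (z - (ω : ℂ)) =
      Complex.exp (latticeLog Dt ω w - latticeLog Dt ω z) := by
    rw [Complex.exp_sub, e1, e2, latticeFactor_eq, latticeFactor_eq,
      mul_div_mul_right _ _ (Complex.exp_ne_zero _)]
  have b3 := norm_sub_le (latticeLog Dt ω w) (latticeLog Dt ω z)
  rw [hr]
  refine (Complex.norm_exp_sub_one_le ?_).trans ?_
  · linarith [norm_nonneg (latticeLog Dt ω w), norm_nonneg (latticeLog Dt ω z)]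
  · linarith

/-- The product over the lattice of the translates of `rationalFun`, which is an elliptic
function. -/
def latticeProd (τ : UpperHalfPlane) (Dt : ℂ →₀ ℤ) (z : ℂ) : ℂ :=
  ∏' ω : lattice τ, latticeFactor Dt (ω : ℂ) z

section
variable {τ : UpperHalfPlane} {Dt : ℂ →₀ ℤ}

theorem hasProd_latticeProd (h0 : (Dt.sum fun _ m => m) = 0)
    (h1 : (Dt.sum fun α m => (m : ℂ) * α) = 0) (z : ℂ) :
    HasProd (fun ω : lattice τ => latticeFactor Dt (ω : ℂ) z) (latticeProd τ Dt z) := by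
  obtain ⟨F, V, -, -, h⟩ := exists_local_factorization τ h0 h1 (‖z‖ + 1)
  exact (h z (by simp)).1.multipliable.hasProd

theorem mem_regularSet_iff {z : ℂ} :
    z ∈ regularSet τ Dt ↔ ∀ ω : lattice τ, z - (ω : ℂ) ∉ Dt.support := by
  constructor
  · intro h ω hω
    exact h _ hω (by simp)
  · intro h α hα hL
    exact h ⟨z - α, hL⟩ (by simpa using hα)

theorem latticeFactor_ne_zero {z : ℂ} (hz : z ∈ regularSet τ Dt) (ω : lattice τ) :
    latticeFactor Dt (ω : ℂ) z ≠ 0 :=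
  mul_ne_zero (rationalFun_ne_zero_iff.mpr (mem_regularSet_iff.mp hz ω)) (Complex.exp_ne_zero _)

theorem latticeProd_ne_zero (h0 : (Dt.sum fun _ m => m) = 0)
    (h1 : (Dt.sum fun α m => (m : ℂ) * α) = 0) {z : ℂ} (hz : z ∈ regularSet τ Dt) :
    latticeProd τ Dt z ≠ 0 := by
  obtain ⟨F, V, -, -, h⟩ := exists_local_factorization τ h0 h1 (‖z‖ + 1)
  rw [latticeProd, (h z (by simp)).1.tprod_eq]
  exact mul_ne_zero (Finset.prod_ne_zero_iff.mpr fun ω _ => latticeFactor_ne_zero hz ω)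
    (Complex.exp_ne_zero _)

/-- One vanishing factor suffices. Since this covers poles as well as zeros, periodicity can be
stated at every point. -/
theorem latticeProd_eq_zero (h0 : (Dt.sum fun _ m => m) = 0)
    (h1 : (Dt.sum fun α m => (m : ℂ) * α) = 0) {z : ℂ} (hz : z ∉ regularSet τ Dt) :
    latticeProd τ Dt z = 0 := by
  obtain ⟨ω, hω⟩ : ∃ ω : lattice τ, z - (ω : ℂ) ∈ Dt.support := by
    simpa [mem_regularSet_iff] using hz
  have hzero : latticeFactor Dt (ω : ℂ) z = 0 := by
    rw [latticeFactor_eq, mul_eq_zero]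
    exact Or.inl (not_not.mp fun h => rationalFun_ne_zero_iff.mp h hω)
  refine (hasProd_latticeProd h0 h1 z).unique ?_
  refine tendsto_const_nhds.congr' ?_
  filter_upwards [eventually_ge_atTop {ω}] with s hs
  exact (Finset.prod_eq_zero (hs (Finset.mem_singleton_self ω)) hzero).symm

theorem add_mem_regularSet_iff {z e : ℂ} (he : e ∈ lattice τ) :
    z + e ∈ regularSet τ Dt ↔ z ∈ regularSet τ Dt := by
  refine forall₂_congr fun α _ => not_congr ?_
  rw [show z + e - α = (z - α) + e by ring]
  exact Submodule.add_mem_iff_left _ he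

/-- The quotient of the two products has factors `a ω`, free of the exponentials. The coordinates Φ
arrange them in rows parallel to e, and each row telescopes to 1. -/
theorem latticeProd_add_of_basis (h0 : (Dt.sum fun _ m => m) = 0)
    (h1 : (Dt.sum fun α m => (m : ℂ) * α) = 0) {e e' : ℂ} (he : e ∈ lattice τ) (hne : e ≠ 0)
    (Φ : ℤ × ℤ ≃ lattice τ) (hΦ : ∀ n m : ℤ, (Φ (n, m) : ℂ) = n * e' - m * e) (z : ℂ) :
    latticeProd τ Dt (z + e) = latticeProd τ Dt z := by
  by_cases hz : z ∈ regularSet τ Dt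
  swap
  · rw [latticeProd_eq_zero h0 h1 hz,
      latticeProd_eq_zero h0 h1 (fun h => hz ((add_mem_regularSet_iff he).mp h))]
  have hR : ∀ ω : lattice τ, rationalFun Dt (z - (ω : ℂ)) ≠ 0 := fun ω =>
    rationalFun_ne_zero_iff.mpr (mem_regularSet_iff.mp hz ω)
  set a : lattice τ → ℂ := fun ω =>
    rationalFun Dt (z + e - (ω : ℂ)) / rationalFun Dt (z - (ω : ℂ)) with ha
  have hsum : Summable fun p : ℤ × ℤ => ‖a (Φ p) - 1‖ :=
    (Φ.summable_iff (f := fun ω => ‖a ω - 1‖)).mpr (summable_ratio_sub_one τ h0 h1 z (z + e))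
  have hmulti : Multipliable (a ∘ Φ) := by
    refine (multipliable_one_add_of_summable hsum).congr fun p => ?_
    rw [Function.comp_apply, add_sub_cancel]
  have hrow : ∀ n : ℤ, HasProd (fun m : ℤ => (a ∘ Φ) (n, m)) 1 := by
    intro n
    -- The sign of m in Φ makes z ↦ z + e the shift m ↦ m + 1.
    set q : ℤ → ℂ := fun m => rationalFun Dt (z - n * e' + m * e) with hq
    have haq : ∀ m : ℤ, (a ∘ Φ) (n, m) = q (m + 1) / q m := by
      intro m
      simp only [Function.comp_apply, ha, hq, hΦ]
      push_cast
      congr 2 <;> ring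
    simp_rw [haq]
    have hnorm : ∀ l : Filter ℤ, Tendsto (fun m : ℤ => |(m : ℝ)|) l atTop →
        Tendsto q l (𝓝 1) := by
      intro l hl
      refine (tendsto_rationalFun h0).comp ?_
      refine tendsto_norm_atTop_iff_cobounded.mp ?_
      refine tendsto_atTop_mono (f := fun m : ℤ => |(m : ℝ)| * ‖e‖ - ‖z - n * e'‖) (fun m => ?_)
        (tendsto_atTop_add_const_right _ _ (hl.atTop_mul_const (norm_pos_iff.mpr hne)))
      have := norm_sub_le (z - n * e' + m * e) (z - n * e')
      rw [add_sub_cancel_left, norm_mul, Complex.norm_intCast] at this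
      linarith
    refine hasProd_int_telescope (fun m => ?_) (hnorm _ ?_) (hnorm _ ?_) ?_
    · have := hR (Φ (n, m))
      rw [hΦ, ← sub_add] at this
      exact this
    · exact tendsto_abs_atTop_atTop.comp tendsto_intCast_atTop_atTop
    · exact tendsto_abs_atBot_atTop.comp (tendsto_intCast_atBot_iff.mpr tendsto_id)
    · refine Multipliable.congr ?_ haq
      have h2 : Summable fun m : ℤ => ‖a (Φ (n, m)) - 1‖ :=
        hsum.comp_injective (i := fun m : ℤ => (n, m)) (Prod.mk_right_injective n)
      refine (multipliable_one_add_of_summable h2).congr fun m => ?_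
      rw [Function.comp_apply, add_sub_cancel]
  have hone : HasProd a 1 := by
    rw [← Φ.hasProd_iff]
    have := hmulti.hasProd.prod_fiberwise hrow
    rw [← this.unique hasProd_one]
    exact hmulti.hasProd
  have hmul := (hasProd_latticeProd (τ := τ) h0 h1 z).mul hone
  rw [mul_one] at hmul
  refine (hasProd_latticeProd h0 h1 (z + e)).unique (hmul.congr_fun fun ω => ?_)
  simp only [ha, latticeFactor_eq]
  field_simp [hR ω]

theorem latticeProd_add (h0 : (Dt.sum fun _ m => m) = 0)
    (h1 : (Dt.sum fun α m => (m : ℂ) * α) = 0) {e : ℂ} (he : e ∈ lattice τ) (z : ℂ) :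
    latticeProd τ Dt (z + e) = latticeProd τ Dt z := by
  have p1 : Function.Periodic (latticeProd τ Dt) (periods τ).ω₁ :=
    latticeProd_add_of_basis (e' := (periods τ).ω₂) h0 h1 (periods τ).ω₁_mem_lattice
      ((periods τ).indep.ne_zero 0)
      -- Sends (n, m) to the lattice point with coordinates (-m, n).
      (((Equiv.prodComm ℤ ℤ).trans ((Equiv.neg ℤ).prodCongr (Equiv.refl ℤ))).trans
        (periods τ).latticeEquivProd.symm.toEquiv)
      (fun n m => by
        refine ((periods τ).latticeEquiv_symm_apply _).trans ?_
        simp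
        ring)
  have p2 : Function.Periodic (latticeProd τ Dt) (periods τ).ω₂ :=
    latticeProd_add_of_basis (e' := (periods τ).ω₁) h0 h1 (periods τ).ω₂_mem_lattice
      ((periods τ).indep.ne_zero 1)
      (((Equiv.refl ℤ).prodCongr (Equiv.neg ℤ)).trans
        (periods τ).latticeEquivProd.symm.toEquiv)
      (fun n m => by
        refine ((periods τ).latticeEquiv_symm_apply _).trans ?_
        simp
        ring)
  obtain ⟨m, n, rfl⟩ := PeriodPair.mem_lattice.mp he
  exact ((p1.int_mul m).add_period (p2.int_mul n)) z

end

end EllipticEisenstein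

/-! ### Divisor and logarithmic derivative -/

namespace EllipticEisenstein
open Filter

open Classical in
theorem meromorphicOrderAt_sub_zpow (c x : ℂ) (n : ℤ) :
    meromorphicOrderAt (fun z : ℂ => (z - c) ^ n) x = ((if x = c then n else 0 : ℤ) : WithTop ℤ) := by
  have hm : MeromorphicAt (fun z : ℂ => (z - c) ^ n) x := by fun_prop
  rw [meromorphicOrderAt_eq_int_iff hm]
  by_cases h : x = c
  · subst h
    exact ⟨fun _ => 1, analyticAt_const, one_ne_zero, by simp⟩
  · have hx : x - c ≠ 0 := sub_ne_zero.mpr h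
    exact ⟨fun z => (z - c) ^ n, AnalyticAt.zpow (by fun_prop) hx, zpow_ne_zero _ hx, by simp [h]⟩

theorem meromorphicAt_latticeFactor (Dt : ℂ →₀ ℤ) (ω x : ℂ) :
    MeromorphicAt (latticeFactor Dt ω) x := by
  unfold latticeFactor
  fun_prop

open Classical in
theorem meromorphicOrderAt_latticeFactor (Dt : ℂ →₀ ℤ) (ω x : ℂ) :
    meromorphicOrderAt (latticeFactor Dt ω) x = ((Dt (x - ω) : ℤ) : WithTop ℤ) := by
  have h1 : latticeFactor Dt ω = fun z =>
      (∏ α ∈ Dt.support, (z - (ω + α)) ^ Dt α) * Complex.exp (halfSecondMoment Dt / ω ^ 2) := by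
    funext z
    simp only [latticeFactor, sub_sub]
  have h2 : meromorphicOrderAt (fun _ : ℂ => Complex.exp (halfSecondMoment Dt / ω ^ 2)) x = 0 := by
    rw [meromorphicOrderAt_const, if_neg (Complex.exp_ne_zero _)]
  rw [h1, fun_meromorphicOrderAt_mul (by fun_prop) (by fun_prop), h2, add_zero,
    meromorphicOrderAt_fun_prod (fun α _ => by fun_prop)]
  simp_rw [meromorphicOrderAt_sub_zpow]
  rw [← WithTop.coe_sum]
  congr 1
  have h3 : ∀ α, (x = ω + α) ↔ (α = x - ω) := fun α => by
    constructor <;> intro h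
    · rw [h]; ring
    · rw [h]; ring
  simp_rw [h3]
  rw [Finset.sum_ite_eq']
  split_ifs with h
  · rfl
  · exact (Finsupp.notMem_support_iff.mp h).symm

section
variable {τ : UpperHalfPlane} {Dt : ℂ →₀ ℤ}

open Classical in
theorem IsLift.apply {D : Curve τ →₀ ℤ} (h : IsLift τ Dt D) (P : Curve τ) :
    D P = ∑ α ∈ Dt.support, if point τ α = P then Dt α else 0 := by
  rw [← h, Finsupp.mapDomain, Finsupp.sum, Finsupp.finsetSum_apply]
  exact Finset.sum_congr rfl fun α _ => Finsupp.single_apply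

theorem point_eq_point_iff {α z : ℂ} : point τ α = point τ z ↔ z - α ∈ lattice τ := by
  rw [eq_comm]
  exact Submodule.Quotient.eq _

/-- Every point of the support above P_z is z - ω for exactly one ω. This turns orders of the
lattice factors into multiplicities of D. -/
theorem IsLift.sum_apply_sub {D : Curve τ →₀ ℤ} (h : IsLift τ Dt D) (z : ℂ)
    (F : Finset (lattice τ)) (hF : ∀ ω : lattice τ, z - (ω : ℂ) ∈ Dt.support → ω ∈ F) :
    ∑ ω ∈ F, Dt (z - (ω : ℂ)) = D (point τ z) := by
  classical
  have h1 : ∀ ω : lattice τ, Dt (z - (ω : ℂ)) =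
      ∑ α ∈ Dt.support, if α = z - (ω : ℂ) then Dt α else 0 := by
    intro ω
    rw [Finset.sum_ite_eq']
    split_ifs with h
    · rfl
    · exact Finsupp.notMem_support_iff.mp h
  rw [h.apply]
  simp_rw [h1]
  rw [Finset.sum_comm]
  refine Finset.sum_congr rfl fun α hα => ?_
  by_cases hL : z - α ∈ lattice τ
  · rw [if_pos (point_eq_point_iff.mpr hL), Finset.sum_eq_single ⟨z - α, hL⟩]
    · simp
    · intro ω _ hω
      refine if_neg fun h => hω (Subtype.ext ?_)
      simp [h]
    · intro hn
      exact absurd (hF ⟨z - α, hL⟩ (by simpa using hα)) hn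
  · rw [if_neg (fun h => hL (point_eq_point_iff.mp h))]
    refine Finset.sum_eq_zero fun ω _ => if_neg fun h => hL ?_
    rw [h]
    simp

theorem meromorphicOrderAt_latticeProd {D : Curve τ →₀ ℤ} (hDt : IsPrincipalLift τ Dt D) (x : ℂ) :
    MeromorphicAt (latticeProd τ Dt) x ∧
      meromorphicOrderAt (latticeProd τ Dt) x = ((D (point τ x) : ℤ) : WithTop ℤ) := by
  obtain ⟨F, V, hF, hV, h⟩ := exists_local_factorization τ hDt.degree_eq_zero hDt.sum_eq_zero
    (‖x‖ + 1)
  have hx : x ∈ Metric.ball (0 : ℂ) (‖x‖ + 1) := by simp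
  have hnhds := Metric.isOpen_ball.mem_nhds hx
  have hA : AnalyticAt ℂ (fun z => Complex.exp (V z)) x := (hV.analyticAt hnhds).cexp
  have heq : (fun z => (∏ ω ∈ F, latticeFactor Dt (ω : ℂ) z) * Complex.exp (V z)) =ᶠ[𝓝 x]
      latticeProd τ Dt := by
    filter_upwards [hnhds] with z hz
    exact ((h z hz).1.tprod_eq).symm
  have hP : ∀ ω ∈ F, MeromorphicAt (latticeFactor Dt (ω : ℂ)) x :=
    fun ω _ => meromorphicAt_latticeFactor _ _ _
  have hPm : MeromorphicAt (fun z => ∏ ω ∈ F, latticeFactor Dt (ω : ℂ) z) x :=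
    MeromorphicAt.fun_prod hP
  refine ⟨(hPm.fun_mul hA.meromorphicAt).congr (heq.filter_mono nhdsWithin_le_nhds), ?_⟩
  rw [← meromorphicOrderAt_congr (heq.filter_mono nhdsWithin_le_nhds),
    fun_meromorphicOrderAt_mul hPm hA.meromorphicAt, meromorphicOrderAt_fun_prod hP]
  have h0 : meromorphicOrderAt (fun z => Complex.exp (V z)) x = 0 :=
    (hA.meromorphicNFAt.meromorphicOrderAt_eq_zero_iff).mpr (Complex.exp_ne_zero _)
  rw [h0, add_zero]
  simp_rw [meromorphicOrderAt_latticeFactor]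
  rw [← WithTop.coe_sum, hDt.isLift.sum_apply_sub x F fun ω hω => ?_]
  -- If z = x were a zero or pole of a factor with ω outside F, then α = x - ω would give 2‖ω‖ <
  -- ‖ω‖.
  by_contra hn
  have := two_mul_norm_sub_lt hω (by linarith) (hF ω hn)
  rw [sub_sub_cancel_left, norm_neg] at this
  linarith [norm_nonneg (ω : ℂ)]

theorem logDeriv_latticeFactor {z : ℂ} (hz : z ∈ regularSet τ Dt) (ω : lattice τ) :
    DifferentiableAt ℂ (latticeFactor Dt (ω : ℂ)) z ∧
      logDeriv (latticeFactor Dt (ω : ℂ)) z = latticeTerm Dt (ω : ℂ) z := by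
  have hne : ∀ α ∈ Dt.support, z - (ω : ℂ) - α ≠ 0 := by
    intro α hα h
    have := mem_regularSet_iff.mp hz ω
    rw [sub_eq_zero.mp h] at this
    exact this hα
  have hd : ∀ α ∈ Dt.support, DifferentiableAt ℂ (fun z : ℂ => (z - (ω : ℂ) - α) ^ Dt α) z :=
    fun α hα => DifferentiableAt.zpow (by fun_prop) (Or.inl (hne α hα))
  have hP : DifferentiableAt ℂ (fun z : ℂ => ∏ α ∈ Dt.support, (z - (ω : ℂ) - α) ^ Dt α) z :=
    DifferentiableAt.fun_finsetProd hd
  refine ⟨hP.mul_const _, ?_⟩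
  unfold latticeFactor
  rw [logDeriv_mul_const _ _ (Complex.exp_ne_zero _), logDeriv_prod
    (f := fun (α : ℂ) (z : ℂ) => (z - (ω : ℂ) - α) ^ Dt α)
    (fun α hα => zpow_ne_zero _ (hne α hα)) hd, latticeTerm, Finsupp.sum]
  refine Finset.sum_congr rfl fun α hα => ?_
  rw [logDeriv_fun_zpow (by fun_prop), logDeriv_apply]
  have : deriv (fun z : ℂ => z - (ω : ℂ) - α) z = 1 := by simp
  rw [this, sub_right_comm, mul_one_div]

theorem analyticAt_latticeProd (h0 : (Dt.sum fun _ m => m) = 0)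
    (h1 : (Dt.sum fun α m => (m : ℂ) * α) = 0) {z : ℂ} (hz : z ∈ regularSet τ Dt) :
    AnalyticAt ℂ (latticeProd τ Dt) z := by
  obtain ⟨F, V, -, hV, h⟩ := exists_local_factorization τ h0 h1 (‖z‖ + 1)
  have hU := (isOpen_regularSet τ Dt).inter (Metric.isOpen_ball (x := (0 : ℂ)) (ε := ‖z‖ + 1))
  have hd : DifferentiableOn ℂ (latticeProd τ Dt)
      (regularSet τ Dt ∩ Metric.ball (0 : ℂ) (‖z‖ + 1)) := by
    have h2 : DifferentiableOn ℂ
        (fun z => (∏ ω ∈ F, latticeFactor Dt (ω : ℂ) z) * Complex.exp (V z))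
        (regularSet τ Dt ∩ Metric.ball (0 : ℂ) (‖z‖ + 1)) := fun w hw =>
      ((DifferentiableAt.fun_finsetProd fun ω _ => (logDeriv_latticeFactor hw.1 ω).1).mul
        (hV.differentiableAt (Metric.isOpen_ball.mem_nhds hw.2)).cexp).differentiableWithinAt
    exact h2.congr fun w hw => (h w hw.2).1.tprod_eq
  exact hd.analyticAt (hU.mem_nhds ⟨hz, by simp⟩)

theorem logDeriv_latticeProd (h0 : (Dt.sum fun _ m => m) = 0)
    (h1 : (Dt.sum fun α m => (m : ℂ) * α) = 0) {z : ℂ} (hz : z ∈ regularSet τ Dt) :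
    logDeriv (latticeProd τ Dt) z = ∑' ω : lattice τ, latticeTerm Dt (ω : ℂ) z := by
  obtain ⟨F, V, -, hV, h⟩ := exists_local_factorization τ h0 h1 (‖z‖ + 1)
  have hzB : z ∈ Metric.ball (0 : ℂ) (‖z‖ + 1) := by simp
  have hnhds := Metric.isOpen_ball.mem_nhds hzB
  have hVd : DifferentiableAt ℂ V z := hV.differentiableAt hnhds
  have heq : latticeProd τ Dt =ᶠ[𝓝 z]
      fun z => (∏ ω ∈ F, latticeFactor Dt (ω : ℂ) z) * Complex.exp (V z) := by
    filter_upwards [hnhds] with w hw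
    exact (h w hw).1.tprod_eq
  have hd : ∀ ω ∈ F, DifferentiableAt ℂ (latticeFactor Dt (ω : ℂ)) z :=
    fun ω _ => (logDeriv_latticeFactor hz ω).1
  rw [logDeriv_apply, heq.deriv_eq, heq.eq_of_nhds, ← logDeriv_apply
    (fun z => (∏ ω ∈ F, latticeFactor Dt (ω : ℂ) z) * Complex.exp (V z)),
    logDeriv_mul (f := fun z => ∏ ω ∈ F, latticeFactor Dt (ω : ℂ) z)
      (g := fun z => Complex.exp (V z)) z (Finset.prod_ne_zero_iff.mpr fun ω _ => latticeFactor_ne_zero hz ω)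
      (Complex.exp_ne_zero _) (DifferentiableAt.fun_finsetProd hd) hVd.cexp,
    logDeriv_prod (fun ω _ => latticeFactor_ne_zero hz ω) hd, ← (h z hzB).2, add_comm]
  congr 1
  · rw [logDeriv_apply, deriv_cexp hVd, mul_div_cancel_left₀ _ (Complex.exp_ne_zero _)]
  · exact Finset.sum_congr rfl fun ω _ => (logDeriv_latticeFactor hz ω).2

/-- Two meromorphic functions with the same periods and the same divisor are proportional. -/
theorem exists_eventually_eq_const_mul {f g : ℂ → ℂ} (hf : MeromorphicOn f Set.univ)
    (hg : MeromorphicOn g Set.univ) (hfp : ∀ ω ∈ lattice τ, ∀ z, f (z + ω) = f z)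
    (hgp : ∀ ω ∈ lattice τ, ∀ z, g (z + ω) = g z) (n : ℂ → ℤ)
    (hfn : ∀ z, meromorphicOrderAt f z = (n z : WithTop ℤ))
    (hgn : ∀ z, meromorphicOrderAt g z = (n z : WithTop ℤ)) :
    ∃ c : ℂ, c ≠ 0 ∧ ∀ x, ∀ᶠ z in 𝓝[≠] x, f z = c * g z := by
  have hq : MeromorphicOn (f / g) Set.univ := hf.div hg
  -- The normal form fills the removable singularities: having order 0 everywhere, h is entire
  -- without zeros.
  set h := toMeromorphicNFOn (f / g) Set.univ with hh
  have hNF : ∀ x, MeromorphicNFAt h x := fun x => meromorphicNFOn_toMeromorphicNFOn _ _ trivial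
  have hord : ∀ x, meromorphicOrderAt h x = 0 := by
    intro x
    rw [hh, meromorphicOrderAt_toMeromorphicNFOn hq trivial,
      meromorphicOrderAt_div (hf x trivial) (hg x trivial), hfn, hgn]
    norm_cast
    simp
  have hA : ∀ x, AnalyticAt ℂ h x := fun x =>
    (hNF x).meromorphicOrderAt_nonneg_iff_analyticAt.mp (hord x).ge
  have hne : ∀ x, h x ≠ 0 := fun x => (hNF x).meromorphicOrderAt_eq_zero_iff.mp (hord x)
  have hd : Differentiable ℂ h := fun x => (hA x).differentiableAt
  have heq : ∀ x, h =ᶠ[𝓝[≠] x] f / g := fun x =>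
    hq.toMeromorphicNFOn_eq_self_on_nhdsNE trivial
  -- The quotient is periodic where h agrees with it, off isolated points; continuity extends this
  -- to every point.
  have hper : ∀ z ω, ω ∈ lattice τ → h (z + ω) = h z := by
    intro z ω hω
    have ht : Tendsto (fun w => w + ω) (𝓝[≠] z) (𝓝[≠] (z + ω)) := by
      refine tendsto_nhdsWithin_iff.mpr ⟨?_, ?_⟩
      · exact ((continuous_add_const ω).tendsto z).mono_left nhdsWithin_le_nhds
      · filter_upwards [self_mem_nhdsWithin] with w hw h
        exact hw (add_right_cancel h)
    have h1 : (fun w => h (w + ω)) =ᶠ[𝓝[≠] z] h := by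
      filter_upwards [ht.eventually (heq (z + ω)), heq z] with w hw1 hw2
      rw [hw1, hw2, Pi.div_apply, Pi.div_apply, hfp ω hω, hgp ω hω]
    have hc : ContinuousAt (fun w => h (w + ω)) z :=
      (hd.continuous.comp (continuous_add_const ω)).continuousAt
    exact ((hc.eventuallyEq_nhds_iff_eventuallyEq_nhdsNE hd.continuous.continuousAt).mp h1).eq_of_nhds
  have hconst : ∀ x, h x = h 0 := fun x =>
    hd.apply_eq_apply_of_bounded
      (IsZLattice.isCompact_range_of_periodic (lattice τ) h hd.continuous hper).isBounded x 0
  refine ⟨h 0, hne 0, fun x => ?_⟩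
  have hg0 : ∀ᶠ z in 𝓝[≠] x, g z ≠ 0 :=
    (meromorphicOrderAt_ne_top_iff_eventually_ne_zero (hg x trivial)).mp (by rw [hgn]; simp)
  filter_upwards [heq x, hg0] with z hz hz0
  rw [← hconst z, hz, Pi.div_apply, div_mul_cancel₀ _ hz0]

theorem normalized_tendsto {D : Curve τ →₀ ℤ} {f : ℂ → ℂ} (hf : IsNormalizedFunction τ D f) :
    Tendsto (fun z => f z / z ^ D 0) (𝓝[≠] (0 : ℂ)) (𝓝 1) := by
  have h1 : Tendsto (fun z : ℂ => z) (𝓝[≠] (0 : ℂ)) (𝓝 0) := nhdsWithin_le_nhds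
  simpa using (hf.normalized.trans_tendsto h1).add_const 1

theorem IsNormalizedFunction.eq {D : Curve τ →₀ ℤ} {f g : ℂ → ℂ}
    (hf : IsNormalizedFunction τ D f) (hg : IsNormalizedFunction τ D g) : f = g := by
  obtain ⟨c, -, h⟩ := exists_eventually_eq_const_mul hf.isElliptic.meromorphicNFOn.meromorphicOn
    hg.isElliptic.meromorphicNFOn.meromorphicOn hf.isElliptic.periodic hg.isElliptic.periodic
    (fun z => D (point τ z)) hf.hasDivisor hg.hasDivisor
  have hc : c = 1 := by
    have h1 : Tendsto (fun z => f z / z ^ D 0) (𝓝[≠] (0 : ℂ)) (𝓝 (c * 1)) := by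
      refine ((normalized_tendsto hg).const_mul c).congr' ?_
      filter_upwards [h 0] with z hz
      rw [hz, mul_div_assoc]
    simpa using tendsto_nhds_unique h1 (normalized_tendsto hf)
  -- Normal forms that agree on a punctured neighbourhood of x agree at x.
  funext x
  refine (((hf.isElliptic.meromorphicNFOn trivial).eventuallyEq_nhdsNE_iff_eventuallyEq_nhds
    (hg.isElliptic.meromorphicNFOn trivial)).mp ?_).eq_of_nhds (x := x)
  filter_upwards [h x] with z hz
  rw [hz, hc, one_mul]

theorem exists_isNormalizedFunction {D : Curve τ →₀ ℤ} (hD : IsPrincipal τ D) :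
    ∃ f, IsNormalizedFunction τ D f := by
  obtain ⟨f, hf, hdiv⟩ := hD
  have hm : MeromorphicAt f 0 := hf.meromorphicNFOn.meromorphicOn 0 trivial
  obtain ⟨g, hg, hg0, hfg⟩ := (meromorphicOrderAt_eq_int_iff hm).mp (hdiv 0)
  have hD0 : D (point τ 0) = D 0 := rfl
  rw [hD0] at hfg
  have hgi : (g 0)⁻¹ ≠ 0 := inv_ne_zero hg0
  refine ⟨fun z => (g 0)⁻¹ * f z, ⟨fun z _ => ?_, fun ω hω z => ?_⟩, fun z => ?_, ?_⟩
  · exact (meromorphicNFAt_mul_iff_right (f := f) (g := fun _ => (g 0)⁻¹) analyticAt_const hgi).mpr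
      (hf.meromorphicNFOn trivial)
  · simp only [hf.periodic ω hω z]
  · rw [← hdiv z]
    exact meromorphicOrderAt_mul_of_ne_zero (f := f) (g := fun _ => (g 0)⁻¹) analyticAt_const hgi
  · have h1 : (fun z => (g 0)⁻¹ * g z - 1) =O[𝓝[≠] (0 : ℂ)] (fun z => z) := by
      have h2 := (hg.differentiableAt.isBigO_sub.mono nhdsWithin_le_nhds : (fun z => g z - g 0)
        =O[𝓝[≠] (0 : ℂ)] fun z => z - 0).const_mul_left (g 0)⁻¹
      simpa [mul_sub, hg0] using h2
    refine h1.congr' ?_ EventuallyEq.rfl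
    filter_upwards [hfg, self_mem_nhdsWithin] with z hz hz0
    have : z ≠ 0 := hz0
    rw [hz, sub_zero, smul_eq_mul]
    field_simp [zpow_ne_zero (D 0) this]

theorem logDeriv_eq_tsum_latticeTerm {D : Curve τ →₀ ℤ} (hDt : IsPrincipalLift τ Dt D)
    {f : ℂ → ℂ} (hf : IsNormalizedFunction τ D f) {z : ℂ} (hz : z ∈ regularSet τ Dt) :
    logDeriv f z = ∑' ω : lattice τ, latticeTerm Dt (ω : ℂ) z := by
  have h0 := hDt.degree_eq_zero
  have h1 := hDt.sum_eq_zero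
  obtain ⟨c, hc, h⟩ := exists_eventually_eq_const_mul hf.isElliptic.meromorphicNFOn.meromorphicOn
    (fun x _ => (meromorphicOrderAt_latticeProd hDt x).1) hf.isElliptic.periodic
    (fun ω hω z => latticeProd_add h0 h1 hω z)
    (fun z => D (point τ z)) hf.hasDivisor (fun x => (meromorphicOrderAt_latticeProd hDt x).2)
  have hA := analyticAt_latticeProd h0 h1 hz
  -- The product is analytic and nonzero at a regular point, so D has multiplicity 0 there and f,
  -- being in normal form, is analytic.
  have hord : meromorphicOrderAt f z = 0 := by
    rw [hf.hasDivisor z, ← (meromorphicOrderAt_latticeProd hDt z).2]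
    exact hA.meromorphicNFAt.meromorphicOrderAt_eq_zero_iff.mpr (latticeProd_ne_zero h0 h1 hz)
  have hfA : AnalyticAt ℂ f z :=
    (hf.isElliptic.meromorphicNFOn trivial).meromorphicOrderAt_nonneg_iff_analyticAt.mp hord.ge
  have hev : f =ᶠ[𝓝 z] fun w => c * latticeProd τ Dt w :=
    (hfA.continuousAt.eventuallyEq_nhds_iff_eventuallyEq_nhdsNE
      (continuousAt_const.mul hA.continuousAt)).mp (h z)
  rw [← logDeriv_latticeProd h0 h1 hz, logDeriv_apply, hev.deriv_eq, hev.eq_of_nhds,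
    ← logDeriv_apply (fun w => c * latticeProd τ Dt w), logDeriv_const_mul _ _ hc]
end

end EllipticEisenstein

/-! ### Second-order estimates for the terms of the Eisenstein series -/

namespace EllipticEisenstein
open Filter
open scoped ComplexConjugate

/-- The summand `1 / (u ^ j |u| ^ (2 s))` of the Eisenstein series. -/
def eisensteinTerm (j : ℕ) (s u : ℂ) : ℂ := 1 / (u ^ j * ((‖u‖ : ℝ) : ℂ) ^ (2 * s))

theorem eisensteinTerm_zero {j : ℕ} (hj : 1 ≤ j) (s : ℂ) : eisensteinTerm j s 0 = 0 := by
  simp [eisensteinTerm, zero_pow (by omega : j ≠ 0)]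

theorem norm_eisensteinTerm (j : ℕ) (s : ℂ) {u : ℂ} (hu : u ≠ 0) :
    ‖eisensteinTerm j s u‖ = ‖u‖ ^ (-(j : ℝ) - 2 * s.re) := by
  have hpos : 0 < ‖u‖ := norm_pos_iff.mpr hu
  rw [eisensteinTerm, norm_div, norm_one, norm_mul, norm_pow,
    Complex.norm_cpow_eq_rpow_re_of_pos hpos, ← Real.rpow_natCast, ← Real.rpow_add hpos,
    one_div, ← Real.rpow_neg hpos.le]
  congr 1
  simp
  ring

theorem differentiable_eisensteinTerm {j : ℕ} (hj : 1 ≤ j) (u : ℂ) :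
    Differentiable ℂ fun s => eisensteinTerm j s u := by
  by_cases hu : u = 0
  · subst hu
    simp_rw [eisensteinTerm_zero hj]
    exact differentiable_const _
  · have hn : ((‖u‖ : ℝ) : ℂ) ≠ 0 := by simpa using hu
    unfold eisensteinTerm
    intro s
    refine DifferentiableAt.div (differentiableAt_const _) ?_ ?_
    · exact (DifferentiableAt.const_cpow (by fun_prop) (Or.inl hn)).const_mul _
    · exact mul_ne_zero (pow_ne_zero _ hu) (by simp [Complex.cpow_eq_zero_iff, hu])

/-- The ratio of the summand at `u (1 + x)` to the summand at `u`, for small `x`. -/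
def eisensteinRatio (j : ℕ) (s x : ℂ) : ℂ :=
  Complex.exp (-(j + s) * Complex.log (1 + x) - s * conj (Complex.log (1 + x)))

/-- |1 + x|^(2s) = exp(s (l + conj l)) for l = log(1 + x); the ratio is thus an exponential of a
real-linear function of l. -/
theorem eisensteinTerm_add (j : ℕ) (s : ℂ) {u b : ℂ} (hu : u ≠ 0) (hb : ‖b / u‖ < 1) :
    eisensteinTerm j s (u + b) = eisensteinTerm j s u * eisensteinRatio j s (b / u) := by
  set x := b / u with hx
  have hub : u + b = u * (1 + x) := by rw [hx]; field_simp
  have hne : 1 + x ≠ 0 := Complex.slitPlane_ne_zero (Complex.mem_slitPlane_of_norm_lt_one hb)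
  have hn : ((‖1 + x‖ : ℝ) : ℂ) ≠ 0 := by simpa using hne
  have hlog : Complex.log (1 + x) + conj (Complex.log (1 + x)) =
      2 * Complex.log ((‖1 + x‖ : ℝ) : ℂ) := by
    rw [Complex.add_conj, Complex.log_re, ← Complex.ofReal_log (norm_nonneg _)]
    push_cast
    ring
  have hR : eisensteinRatio j s x = 1 / ((1 + x) ^ j * ((‖1 + x‖ : ℝ) : ℂ) ^ (2 * s)) := by
    have h1 : (1 + x) ^ j = Complex.exp (j * Complex.log (1 + x)) := by
      rw [Complex.exp_nat_mul, Complex.exp_log hne]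
    rw [Complex.cpow_def_of_ne_zero hn, h1, ← Complex.exp_add, one_div, ← Complex.exp_neg,
      eisensteinRatio]
    congr 1
    linear_combination (-s) * hlog
  rw [hR, eisensteinTerm, eisensteinTerm, hub, norm_mul, Complex.ofReal_mul,
    Complex.mul_cpow_ofReal_nonneg (norm_nonneg _) (norm_nonneg _), mul_pow, ← one_div_mul_one_div,
    div_mul_div_comm]
  simp only [one_div, mul_inv]
  ring

theorem norm_eisensteinRatio_sub_le {j : ℕ} {B K : ℝ} (hB : 0 ≤ B) (hK : K = j + 2 * B + 1)
    {s x : ℂ} (hs : ‖s‖ ≤ B) (hx : ‖x‖ ≤ 1 / (2 * K)) :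
    ‖eisensteinRatio j s x - (1 - (j + s) * x - s * conj x)‖ ≤ 4 * K ^ 2 * ‖x‖ ^ 2 := by
  -- K bounds |j + s| + |s|, so the exponent w has norm at most (3/2) K ‖x‖ ≤ 3/4. The errors 9/4 K²
  -- from exp and K from log then fit under 4 K².
  have hK1 : 1 ≤ K := by
    have : (0 : ℝ) ≤ j := Nat.cast_nonneg j
    linarith
  have hxK : K * ‖x‖ ≤ 1 / 2 := by
    rw [le_div_iff₀ (by linarith)] at hx
    linarith
  have hx2 : ‖x‖ ≤ 1 / 2 := by nlinarith [norm_nonneg x]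
  set l := Complex.log (1 + x) with hl
  have hl1 : ‖l‖ ≤ 3 / 2 * ‖x‖ := Complex.norm_log_one_add_half_le_self hx2
  have hl2 : ‖l - x‖ ≤ ‖x‖ ^ 2 := by
    have h := Complex.norm_log_one_add_sub_self_le (z := x) (by linarith)
    have h2 : (1 - ‖x‖)⁻¹ ≤ 2 := by
      rw [inv_le_comm₀ (by linarith) two_pos]
      linarith
    nlinarith [mul_le_mul_of_nonneg_left h2 (sq_nonneg ‖x‖)]
  have hjs : ‖-((j : ℂ) + s)‖ ≤ j + B := by
    rw [norm_neg]
    refine (norm_add_le _ _).trans ?_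
    rw [Complex.norm_natCast]
    linarith
  have hlin : ∀ y : ℂ, ‖-((j : ℂ) + s) * y - s * conj y‖ ≤ K * ‖y‖ := by
    intro y
    refine (norm_sub_le _ _).trans ?_
    rw [norm_mul, norm_mul, RCLike.norm_conj]
    nlinarith [mul_le_mul_of_nonneg_right hjs (norm_nonneg y),
      mul_le_mul_of_nonneg_right hs (norm_nonneg y), norm_nonneg y]
  set w := -((j : ℂ) + s) * l - s * conj l with hw
  have hw1 : ‖w‖ ≤ K * (3 / 2 * ‖x‖) :=
    (hlin l).trans (mul_le_mul_of_nonneg_left hl1 (by linarith))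
  have hw2 := Complex.norm_exp_sub_one_sub_id_le (x := w) (by linarith)
  have hw3 := (hlin (l - x)).trans (mul_le_mul_of_nonneg_left hl2 (by linarith))
  have hsplit : eisensteinRatio j s x - (1 - (j + s) * x - s * conj x) =
      (Complex.exp w - 1 - w) + (-((j : ℂ) + s) * (l - x) - s * conj (l - x)) := by
    rw [eisensteinRatio, ← hl, ← hw, map_sub, hw]
    ring
  rw [hsplit]
  refine (norm_add_le _ _).trans ((add_le_add hw2 hw3).trans ?_)
  have : ‖w‖ ^ 2 ≤ (K * (3 / 2 * ‖x‖)) ^ 2 := by gcongr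
  nlinarith [sq_nonneg ‖x‖, mul_nonneg (mul_nonneg (by linarith : (0 : ℝ) ≤ K)
    (by linarith : 0 ≤ K - 1)) (sq_nonneg ‖x‖)]

/-- The remainder of the first-order Taylor expansion of the summand at `u`. -/
def eisensteinRemainder (j : ℕ) (s u b : ℂ) : ℂ :=
  eisensteinTerm j s (u + b) -
    eisensteinTerm j s u * (1 - (j + s) * (b / u) - s * conj (b / u))

/-- For j ≥ 1 and Re s ≥ -1/4 the term is at most ‖u‖^(-1/2), and a second-order remainder gains
‖u‖⁻². The exponent 5/2 exceeds 2, which is what summability over the lattice requires. -/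
theorem exists_norm_eisensteinRemainder_le {j : ℕ} (hj : 1 ≤ j) (B M : ℝ) :
    ∃ C R : ℝ, 0 ≤ C ∧ 1 ≤ R ∧ ∀ s u b : ℂ, ‖s‖ ≤ B → -(1 / 4) ≤ s.re → R ≤ ‖u‖ → ‖b‖ ≤ M →
      ‖eisensteinRemainder j s u b‖ ≤ C * ‖u‖ ^ (-(5 / 2) : ℝ) := by
  set K : ℝ := j + 2 * |B| + 1 with hK
  have hK1 : 1 ≤ K := by
    have : (0 : ℝ) ≤ j := Nat.cast_nonneg j
    linarith [abs_nonneg B]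
  refine ⟨4 * K ^ 2 * M ^ 2, max 1 (2 * K * |M|), by positivity, le_max_left _ _,
    fun s u b hs hre hu hb => ?_⟩
  have hu1 : 1 ≤ ‖u‖ := (le_max_left _ _).trans hu
  have hu0 : 0 < ‖u‖ := by linarith
  have hne : u ≠ 0 := norm_pos_iff.mp hu0
  have hx : ‖b / u‖ ≤ 1 / (2 * K) := by
    rw [norm_div, div_le_div_iff₀ hu0 (by linarith)]
    have h1 : 2 * K * |M| ≤ ‖u‖ := (le_max_right _ _).trans hu
    have h2 : ‖b‖ ≤ |M| := hb.trans (le_abs_self M)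
    nlinarith
  have hx1 : ‖b / u‖ < 1 := by
    refine hx.trans_lt ?_
    rw [div_lt_one (by linarith)]
    linarith
  have h1 : ‖eisensteinTerm j s u‖ ≤ ‖u‖ ^ (-(1 / 2) : ℝ) := by
    rw [norm_eisensteinTerm j s hne]
    refine Real.rpow_le_rpow_of_exponent_le hu1 ?_
    have : (1 : ℝ) ≤ j := by exact_mod_cast hj
    linarith
  have h2 := norm_eisensteinRatio_sub_le (j := j) (abs_nonneg B) hK (hs.trans (le_abs_self B)) hx
  have h3 : ‖u‖ ^ (-(5 / 2) : ℝ) = ‖u‖ ^ (-(1 / 2) : ℝ) / ‖u‖ ^ 2 := by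
    rw [show (-(5 / 2) : ℝ) = -(1 / 2) - 2 by norm_num, Real.rpow_sub hu0]
    norm_cast
  rw [eisensteinRemainder, eisensteinTerm_add j s hne hx1, ← mul_sub, norm_mul, h3]
  calc _ ≤ ‖u‖ ^ (-(1 / 2) : ℝ) * (4 * K ^ 2 * ‖b / u‖ ^ 2) :=
        mul_le_mul h1 h2 (norm_nonneg _) (by positivity)
    _ ≤ ‖u‖ ^ (-(1 / 2) : ℝ) * (4 * K ^ 2 * (M ^ 2 / ‖u‖ ^ 2)) := by
        rw [norm_div, div_pow]
        gcongr
    _ = _ := by ring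

/-- Lattice sums of entire functions of `s`, with terms `O(|α + ω| ^ (-5 / 2))` locally uniformly
on `Re s > -1 / 4`, are holomorphic there. -/
theorem differentiableOn_tsum_lattice {τ : UpperHalfPlane} {α : ℂ} {A : lattice τ → ℂ → ℂ}
    (hA : ∀ ω, Differentiable ℂ (A ω))
    (hb : ∀ B : ℝ, ∃ C R : ℝ, ∀ (ω : lattice τ) (s : ℂ), R ≤ ‖α + (ω : ℂ)‖ → ‖s‖ ≤ B →
      -(1 / 4) ≤ s.re → ‖A ω s‖ ≤ C * ‖α + (ω : ℂ)‖ ^ (-(5 / 2) : ℝ)) :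
    DifferentiableOn ℂ (fun s => ∑' ω, A ω s) {s | -(1 / 4) < s.re} ∧
      ∀ s : ℂ, -(1 / 4) ≤ s.re → Summable fun ω => ‖A ω s‖ := by
  classical
  have hsum := summable_norm_add_rpow τ α (r := -(5 / 2)) (by norm_num)
  refine ⟨fun s₀ hs₀ => ?_, fun s hs => ?_⟩
  · obtain ⟨C, R, h⟩ := hb (‖s₀‖ + 1)
    -- The finitely many terms with small α + ω are bounded by compactness.
    have hc : ∀ ω, ∃ c, ∀ s ∈ Metric.closedBall (0 : ℂ) (‖s₀‖ + 1), ‖A ω s‖ ≤ c := fun ω =>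
      (isCompact_closedBall _ _).exists_bound_of_continuousOn (hA ω).continuous.continuousOn
    choose c hc using hc
    set u : lattice τ → ℝ := fun ω =>
      if R ≤ ‖α + (ω : ℂ)‖ then C * ‖α + (ω : ℂ)‖ ^ (-(5 / 2) : ℝ) else c ω with hu
    have hus : Summable u := by
      refine (summable_congr_cofinite ?_).mpr (hsum.mul_left C)
      filter_upwards [eventually_lt_norm_add τ α R] with ω hω
      simp only [hu, if_pos hω.le]
    have hU : IsOpen (Metric.ball (0 : ℂ) (‖s₀‖ + 1) ∩ {s : ℂ | -(1 / 4) < s.re}) :=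
      Metric.isOpen_ball.inter (isOpen_lt continuous_const Complex.continuous_re)
    have hd := Complex.differentiableOn_tsum_of_summable_norm hus
      (fun ω => (hA ω).differentiableOn) hU (fun ω s hs => by
        have hsb := Metric.ball_subset_closedBall hs.1
        have hsre : -(1 / 4) < s.re := hs.2
        by_cases hω : R ≤ ‖α + (ω : ℂ)‖
        · simp only [hu, if_pos hω]
          exact h ω s hω (mem_closedBall_zero_iff.mp hsb) hsre.le
        · simp only [hu, if_neg hω]
          exact hc ω s hsb)
    exact (hd.differentiableAt (hU.mem_nhds ⟨by simp, hs₀⟩)).differentiableWithinAt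
  · obtain ⟨C, R, h⟩ := hb ‖s‖
    refine Summable.of_norm_bounded_eventually (hsum.mul_left C) ?_
    filter_upwards [eventually_lt_norm_add τ α R] with ω hω
    rw [norm_norm]
    exact h ω s hω.le le_rfl hs

/-- The omitted term is 1/0 = 0, because j ≥ 1. -/
theorem eisensteinSeries_eq_tsum (τ : UpperHalfPlane) {j : ℕ} (hj : 1 ≤ j) (α s : ℂ) :
    eisensteinSeries τ j α s = ∑' ω : lattice τ, eisensteinTerm j s (α + (ω : ℂ)) := by
  refine (tsum_subtype {ω : lattice τ | α + (ω : ℂ) ≠ 0}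
    (fun ω : lattice τ => eisensteinTerm j s (α + (ω : ℂ)))).trans (tsum_congr fun ω => ?_)
  by_cases h : α + (ω : ℂ) = 0
  · rw [h, eisensteinTerm_zero hj, Set.indicator_of_notMem]
    simpa using h
  · rw [Set.indicator_of_mem]
    simpa using h

theorem summable_eisensteinTerm (τ : UpperHalfPlane) {j : ℕ} (α : ℂ) {s : ℂ}
    (hs : 1 - (j : ℝ) / 2 < s.re) :
    Summable fun ω : lattice τ => eisensteinTerm j s (α + (ω : ℂ)) := by
  refine Summable.of_norm_bounded_eventually
    (summable_norm_add_rpow τ α (r := -(j : ℝ) - 2 * s.re) (by linarith)) ?_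
  filter_upwards [eventually_lt_norm_add τ α 0] with ω hω
  exact (norm_eisensteinTerm j s (norm_pos_iff.mp hω)).le

end EllipticEisenstein

/-! ### Analytic continuation of the Eisenstein series -/

namespace EllipticEisenstein
open Filter MeasureTheory

/-- The summand of the Eisenstein series, cut off to `1 ≤ |u|`. -/
def eisensteinCutoff (j : ℕ) (s u : ℂ) : ℂ := if 1 ≤ ‖u‖ then eisensteinTerm j s u else 0

theorem measurable_eisensteinTerm (j : ℕ) (s : ℂ) : Measurable (eisensteinTerm j s) := by
  unfold eisensteinTerm
  fun_prop

theorem measurable_eisensteinCutoff (j : ℕ) (s : ℂ) : Measurable (eisensteinCutoff j s) :=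
  Measurable.ite (measurableSet_le measurable_const measurable_norm)
    (measurable_eisensteinTerm j s) measurable_const

theorem integrable_eisensteinCutoff {j : ℕ} {s : ℂ} (hs : 1 - (j : ℝ) / 2 < s.re) :
    Integrable (eisensteinCutoff j s) := by
  set r : ℝ := j + 2 * s.re with hr
  have hr2 : 2 < r := by linarith
  -- For ‖u‖ ≥ 1 one has 1 + ‖u‖ ≤ 2‖u‖, whence the factor 2^r.
  have hi : Integrable fun u : ℂ => (2 : ℝ) ^ r * (1 + ‖u‖) ^ (-r) :=
    (integrable_one_add_norm (by simpa using hr2)).const_mul _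
  refine hi.mono' (measurable_eisensteinCutoff j s).aestronglyMeasurable
    (Eventually.of_forall fun u => ?_)
  rw [eisensteinCutoff]
  split_ifs with h
  · have hu : 0 < ‖u‖ := by linarith
    rw [norm_eisensteinTerm j s (norm_pos_iff.mp hu),
      show -(j : ℝ) - 2 * s.re = -r by rw [hr]; ring,
      Real.rpow_neg hu.le, Real.rpow_neg (by positivity), ← div_eq_mul_inv,
      ← Real.div_rpow (by norm_num) (by positivity), ← Real.inv_rpow hu.le]
    refine Real.rpow_le_rpow (by positivity) ?_ (by linarith)
    rw [inv_eq_one_div, div_le_div_iff₀ hu (by positivity)]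
    linarith
  · rw [norm_zero]
    positivity

/-- Rotation by π/j preserves area and |u| but changes the sign of u^j, so the integral equals its
own negative. -/
theorem integral_eisensteinCutoff {j : ℕ} (hj : 1 ≤ j) (s : ℂ) :
    ∫ u : ℂ, eisensteinCutoff j s u = 0 := by
  set c : Circle := Circle.exp (Real.pi / j) with hc
  have hcj : (c : ℂ) ^ j = -1 := by
    have hj0 : (j : ℂ) ≠ 0 := by exact_mod_cast (by omega : j ≠ 0)
    rw [hc, Circle.coe_exp, ← Complex.exp_nat_mul, ← Complex.exp_pi_mul_I]
    congr 1
    push_cast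
    field_simp
  have hrot : ∀ u : ℂ, eisensteinCutoff j s (rotation c u) = -eisensteinCutoff j s u := by
    intro u
    have hn : ‖(c : ℂ) * u‖ = ‖u‖ := by rw [norm_mul, Circle.norm_coe, one_mul]
    simp only [eisensteinCutoff, eisensteinTerm, rotation_apply, hn, mul_pow, hcj]
    split_ifs
    · rw [neg_one_mul, neg_mul, one_div, one_div, inv_neg]
    · simp
  have h := (rotation c).measurePreserving.integral_comp
    (rotation c).toHomeomorph.measurableEmbedding (eisensteinCutoff j s)
  simp_rw [hrot, integral_neg] at h
  linear_combination (-1 / 2 : ℂ) * h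

/-- A fundamental domain of the lattice. -/
def cell (τ : UpperHalfPlane) : Set ℂ :=
  ZSpan.fundamentalDomain ((periods τ).latticeBasis.ofZLatticeBasis ℝ)

theorem isAddFundamentalDomain_cell (τ : UpperHalfPlane) :
    IsAddFundamentalDomain (lattice τ) (cell τ) volume :=
  ZLattice.isAddFundamentalDomain _ _

theorem isBounded_cell (τ : UpperHalfPlane) : Bornology.IsBounded (cell τ) :=
  ZSpan.fundamentalDomain_isBounded _

theorem measurableSet_cell (τ : UpperHalfPlane) : MeasurableSet (cell τ) :=
  ZSpan.fundamentalDomain_measurableSet _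

theorem volume_cell_lt_top (τ : UpperHalfPlane) : volume (cell τ) < ⊤ :=
  (isBounded_cell τ).measure_lt_top

theorem volume_real_cell_pos (τ : UpperHalfPlane) : 0 < volume.real (cell τ) :=
  ENNReal.toReal_pos (ZSpan.measure_fundamentalDomain_ne_zero _) (volume_cell_lt_top τ).ne

instance (τ : UpperHalfPlane) : VAddInvariantMeasure (lattice τ) ℂ volume :=
  inferInstanceAs (VAddInvariantMeasure (lattice τ).toAddSubgroup ℂ volume)

open Pointwise in
theorem hasSum_setIntegral_cell (τ : UpperHalfPlane) {h : ℂ → ℂ} (hh : Integrable h) :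
    HasSum (fun ω : lattice τ => ∫ x in cell τ, h ((ω : ℂ) + x)) (∫ x, h x) := by
  have hF := isAddFundamentalDomain_cell τ
  have h1 : Measure.sum (fun ω : lattice τ => (volume : Measure ℂ).restrict (ω +ᵥ cell τ)) =
      volume := hF.sum_restrict
  have h2 := hasSum_integral_measure (f := h)
    (μ := fun ω : lattice τ => (volume : Measure ℂ).restrict (ω +ᵥ cell τ)) (by rwa [h1])
  rw [h1] at h2
  refine h2.congr_fun fun ω => ?_
  exact ((measurePreserving_vadd ω (volume : Measure ℂ)).setIntegral_image_emb
    (measurableEmbedding_const_vadd ω) h (cell τ)).symm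

theorem hasDerivAt_eisensteinCutoff (j : ℕ) (s u : ℂ) :
    HasDerivAt (fun s => eisensteinCutoff j s u)
      (-(2 * Real.log ‖u‖) * eisensteinCutoff j s u) s := by
  by_cases h : 1 ≤ ‖u‖
  · have hpos : 0 < ‖u‖ := by linarith
    have hu : u ≠ 0 := norm_pos_iff.mp hpos
    have hn : ((‖u‖ : ℝ) : ℂ) ≠ 0 := by simpa using hu
    simp only [eisensteinCutoff, if_pos h, eisensteinTerm]
    have h1 : HasDerivAt (fun s : ℂ => (2 * s)) 2 s := by
      simpa using (hasDerivAt_id s).const_mul (2 : ℂ)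
    have h2 := (h1.const_cpow (c := ((‖u‖ : ℝ) : ℂ)) (Or.inl hn)).const_mul (u ^ j)
    have hne : u ^ j * ((‖u‖ : ℝ) : ℂ) ^ (2 * s) ≠ 0 :=
      mul_ne_zero (pow_ne_zero _ hu) (by simp [Complex.cpow_eq_zero_iff, hu])
    have h3 := (hasDerivAt_const s (1 : ℂ)).div h2 hne
    refine h3.congr_deriv ?_
    rw [Complex.ofReal_log hpos.le]
    field_simp
    ring
  · simp only [eisensteinCutoff, if_neg h, mul_zero]
    exact hasDerivAt_const _ _

theorem norm_eisensteinCutoff_le (j : ℕ) {s u : ℂ} {M S : ℝ} (hu : ‖u‖ ≤ M) (hs : ‖s‖ ≤ S) :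
    ‖eisensteinCutoff j s u‖ ≤ max 1 M ^ (2 * S) := by
  rw [eisensteinCutoff]
  split_ifs with h
  · have hpos : 0 < ‖u‖ := by linarith
    have h1 : -s.re ≤ S := (neg_le_abs _).trans ((Complex.abs_re_le_norm s).trans hs)
    have hS : 0 ≤ S := (norm_nonneg s).trans hs
    have hj : (0 : ℝ) ≤ j := Nat.cast_nonneg j
    rw [norm_eisensteinTerm j s (norm_pos_iff.mp hpos)]
    exact (Real.rpow_le_rpow_of_exponent_le h (by linarith)).trans
      (Real.rpow_le_rpow hpos.le (hu.trans (le_max_right _ _)) (by linarith))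
  · rw [norm_zero]
    positivity

/-- Differentiation under the integral sign. The cutoff keeps log ‖g x‖ nonnegative, and boundedness
of the cell bounds it above. -/
theorem differentiable_setIntegral_eisensteinCutoff (τ : UpperHalfPlane) (j : ℕ) {g : ℂ → ℂ}
    (hg : Continuous g) :
    Differentiable ℂ fun s => ∫ x in cell τ, eisensteinCutoff j s (g x) := by
  intro s₀
  obtain ⟨M, hM⟩ : ∃ M, ∀ x ∈ cell τ, ‖g x‖ ≤ M := by
    obtain ⟨M, hM⟩ := (isBounded_cell τ).isCompact_closure.exists_bound_of_continuousOn
      hg.continuousOn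
    exact ⟨M, fun x hx => hM x (subset_closure hx)⟩
  have hmeas : ∀ s, AEStronglyMeasurable (fun x => eisensteinCutoff j s (g x))
      (volume.restrict (cell τ)) := fun s =>
    ((measurable_eisensteinCutoff j s).comp hg.measurable).aestronglyMeasurable
  have hfin : IsFiniteMeasure ((volume : Measure ℂ).restrict (cell τ)) :=
    ⟨by simpa using volume_cell_lt_top τ⟩
  set S := ‖s₀‖ + 1 with hS
  have hb : ∀ s ∈ Metric.ball s₀ 1, ‖s‖ ≤ S := by
    intro s hs
    have := norm_le_norm_add_norm_sub' s s₀
    rw [mem_ball_iff_norm] at hs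
    linarith
  refine (hasDerivAt_integral_of_dominated_loc_of_deriv_le (s := Metric.ball s₀ 1)
    (F := fun s x => eisensteinCutoff j s (g x))
    (F' := fun s x => -(2 * Real.log ‖g x‖) * eisensteinCutoff j s (g x))
    (bound := fun _ => 2 * max 1 M * max 1 M ^ (2 * S))
    (Metric.ball_mem_nhds s₀ one_pos) (Eventually.of_forall hmeas) ?_ ?_ ?_
    (integrable_const _) ?_).2.differentiableAt
  · refine (integrable_const (max 1 M ^ (2 * S))).mono' (hmeas s₀) ?_
    filter_upwards [ae_restrict_mem (measurableSet_cell τ)] with x hx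
    exact norm_eisensteinCutoff_le j (hM x hx) (hb s₀ (Metric.mem_ball_self one_pos))
  · refine AEStronglyMeasurable.mul ?_ (hmeas s₀)
    have : Measurable fun x => -(2 * ((Real.log ‖g x‖ : ℝ) : ℂ)) := by
      have := hg.measurable
      fun_prop
    exact this.aestronglyMeasurable
  · filter_upwards [ae_restrict_mem (measurableSet_cell τ)] with x hx s hs
    by_cases h1 : 1 ≤ ‖g x‖
    · rw [norm_mul, norm_neg, norm_mul, Complex.norm_real, Complex.norm_two,
        Real.norm_of_nonneg (Real.log_nonneg h1)]
      have hl : Real.log ‖g x‖ ≤ max 1 M :=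
        (Real.log_le_self (norm_nonneg _)).trans ((hM x hx).trans (le_max_right _ _))
      have := norm_eisensteinCutoff_le j (hM x hx) (hb s hs)
      have := Real.log_nonneg h1
      gcongr
    · rw [eisensteinCutoff, if_neg h1, mul_zero, norm_zero]
      positivity
  · exact Eventually.of_forall fun x s _ => hasDerivAt_eisensteinCutoff j s (g x)

/-- The term of the Eisenstein series at `v`, minus its symmetrized average over a cell. -/
def eisensteinDefect (τ : UpperHalfPlane) (j : ℕ) (s v : ℂ) : ℂ :=
  eisensteinTerm j s v - (2 * volume.real (cell τ) : ℂ)⁻¹ *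
    ((∫ x in cell τ, eisensteinCutoff j s (v + x)) + ∫ x in cell τ, eisensteinCutoff j s (v - x))

theorem integrableOn_eisensteinCutoff (τ : UpperHalfPlane) (j : ℕ) (s : ℂ) {g : ℂ → ℂ}
    (hg : Continuous g) : IntegrableOn (fun x => eisensteinCutoff j s (g x)) (cell τ) := by
  obtain ⟨M, hM⟩ := (isBounded_cell τ).isCompact_closure.exists_bound_of_continuousOn
    hg.continuousOn
  have hc : IntegrableOn (fun _ : ℂ => max 1 M ^ (2 * ‖s‖)) (cell τ) :=
    integrableOn_const (volume_cell_lt_top τ).ne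
  refine hc.mono' ((measurable_eisensteinCutoff j s).comp hg.measurable).aestronglyMeasurable ?_
  filter_upwards [ae_restrict_mem (measurableSet_cell τ)] with x hx
  exact norm_eisensteinCutoff_le j (hM x (subset_closure hx)) le_rfl

/-- The cell need not be symmetric about 0. Averaging over both x and -x cancels the terms linear in
x and conj x and leaves second-order remainders. -/
theorem exists_norm_eisensteinDefect_le (τ : UpperHalfPlane) {j : ℕ} (hj : 1 ≤ j) (B : ℝ) :
    ∃ C R : ℝ, ∀ v s : ℂ, R ≤ ‖v‖ → ‖s‖ ≤ B → -(1 / 4) ≤ s.re →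
      ‖eisensteinDefect τ j s v‖ ≤ C * ‖v‖ ^ (-(5 / 2) : ℝ) := by
  obtain ⟨M, hM⟩ := (isBounded_cell τ).exists_norm_le
  obtain ⟨C, R, hC, hR, h⟩ := exists_norm_eisensteinRemainder_le hj B M
  -- Beyond M + 1 the points v ± x have norm at least 1, so the cutoff has no effect.
  refine ⟨C, max R (M + 1), fun v s hv hs hre => ?_⟩
  have hvR : R ≤ ‖v‖ := (le_max_left _ _).trans hv
  have hvM : M + 1 ≤ ‖v‖ := (le_max_right _ _).trans hv
  set A := volume.real (cell τ) with hA
  have hA0 : 0 < A := volume_real_cell_pos τ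
  have hAc : (A : ℂ) ≠ 0 := by exact_mod_cast hA0.ne'
  have hcut : ∀ b : ℂ, ‖b‖ ≤ M → eisensteinCutoff j s (v + b) = eisensteinTerm j s (v + b) := by
    intro b hb
    rw [eisensteinCutoff, if_pos]
    have := norm_sub_le (v + b) b
    rw [add_sub_cancel_right] at this
    linarith
  have hint : eisensteinDefect τ j s v = (2 * A : ℂ)⁻¹ * ∫ x in cell τ,
      -(eisensteinRemainder j s v x + eisensteinRemainder j s v (-x)) := by
    have h1 : ∫ x in cell τ, -(eisensteinRemainder j s v x + eisensteinRemainder j s v (-x)) =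
        ∫ x in cell τ, (2 * eisensteinTerm j s v -
          (eisensteinCutoff j s (v + x) + eisensteinCutoff j s (v - x))) := by
      refine setIntegral_congr_fun (measurableSet_cell τ) fun x hx => ?_
      have hx1 := hcut x (hM x hx)
      have hx2 := hcut (-x) (by rw [norm_neg]; exact hM x hx)
      simp only [eisensteinRemainder, sub_eq_add_neg v x, hx1, hx2, neg_div, map_neg]
      ring
    have hi1 := integrableOn_eisensteinCutoff τ j s (g := fun x => v + x) (by fun_prop)
    have hi2 := integrableOn_eisensteinCutoff τ j s (g := fun x => v - x) (by fun_prop)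
    have h2 := integral_sub (μ := volume.restrict (cell τ))
      (f := fun _ : ℂ => 2 * eisensteinTerm j s v)
      (integrableOn_const (volume_cell_lt_top τ).ne) (hi1.add hi2)
    have h3 := integral_add hi1 hi2
    rw [h1]
    refine Eq.trans ?_ (congrArg _ h2.symm)
    simp only [Pi.add_apply]
    rw [h3, setIntegral_const, ← hA, eisensteinDefect, ← hA, Complex.real_smul]
    field_simp
  have hbound : ‖∫ x in cell τ,
      -(eisensteinRemainder j s v x + eisensteinRemainder j s v (-x))‖ ≤
      2 * (C * ‖v‖ ^ (-(5 / 2) : ℝ)) * A := by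
    refine norm_setIntegral_le_of_norm_le_const (volume_cell_lt_top τ) fun x hx => ?_
    rw [norm_neg]
    refine (norm_add_le _ _).trans ?_
    have := h s v x hs hre hvR (hM x hx)
    have := h s v (-x) hs hre hvR (by rw [norm_neg]; exact hM x hx)
    linarith
  rw [hint, norm_mul, norm_inv, norm_mul, Complex.norm_two, Complex.norm_real,
    Real.norm_of_nonneg hA0.le, inv_mul_le_iff₀ (by positivity)]
  linarith

theorem differentiable_eisensteinDefect (τ : UpperHalfPlane) {j : ℕ} (hj : 1 ≤ j) (v : ℂ) :
    Differentiable ℂ fun s => eisensteinDefect τ j s v :=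
  (differentiable_eisensteinTerm hj v).sub
    (((differentiable_setIntegral_eisensteinCutoff τ j (g := fun x => v + x) (by fun_prop)).add
      (differentiable_setIntegral_eisensteinCutoff τ j (g := fun x => v - x)
        (by fun_prop))).const_mul _)

/-- The analytic continuation of the Eisenstein series to `Re s > -1 / 4`. -/
def eisensteinContinuation (τ : UpperHalfPlane) (j : ℕ) (α s : ℂ) : ℂ :=
  ∑' ω : lattice τ, eisensteinDefect τ j s (α + (ω : ℂ))

theorem differentiableOn_eisensteinContinuation (τ : UpperHalfPlane) {j : ℕ} (hj : 1 ≤ j) (α : ℂ) :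
    DifferentiableOn ℂ (eisensteinContinuation τ j α) {s | -(1 / 4) < s.re} :=
  (differentiableOn_tsum_lattice (A := fun ω s => eisensteinDefect τ j s (α + (ω : ℂ)))
    (fun _ => differentiable_eisensteinDefect τ hj _) fun B => by
      obtain ⟨C, R, h⟩ := exists_norm_eisensteinDefect_le τ hj B
      exact ⟨C, R, fun ω s => h _ s⟩).1

/-- In the region of absolute convergence the subtracted averages reassemble to integrals over the
whole plane, which vanish. -/
theorem eisensteinContinuation_eq (τ : UpperHalfPlane) {j : ℕ} (hj : 1 ≤ j) (α : ℂ) {s : ℂ}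
    (hs : 1 - (j : ℝ) / 2 < s.re) :
    eisensteinContinuation τ j α s = eisensteinSeries τ j α s := by
  have hi := integrable_eisensteinCutoff hs
  have h1 := hasSum_setIntegral_cell τ (hi.comp_add_left α)
  have h2 := hasSum_setIntegral_cell τ (hi.comp_sub_left α)
  rw [integral_add_left_eq_self (eisensteinCutoff j s) α, integral_eisensteinCutoff hj] at h1
  rw [integral_sub_left_eq_self (eisensteinCutoff j s) volume α,
    integral_eisensteinCutoff hj] at h2
  -- Replacing ω by -ω turns α - (ω + x) into (α + ω) - x.
  have h3 := (Equiv.neg (lattice τ)).hasSum_iff.mpr h2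
  have h4 := (summable_eisensteinTerm τ α hs).hasSum.sub
    ((h1.add h3).mul_left (2 * volume.real (cell τ) : ℂ)⁻¹)
  rw [eisensteinSeries_eq_tsum τ hj, eisensteinContinuation]
  refine (Eq.trans (tsum_congr fun ω => ?_) h4.tsum_eq).trans (by simp)
  rw [eisensteinDefect]
  congr 3
  · simp only [add_assoc]
  · simp only [Function.comp_apply, Equiv.neg_apply, Submodule.coe_neg]
    congr 1 with x
    congr 1
    ring

theorem eisenstein_zero_eq (τ : UpperHalfPlane) {j : ℕ} (hj : 1 ≤ j) (α : ℂ) :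
    eisenstein τ j α 0 = eisensteinContinuation τ j α 0 := by
  have h : IsContinuedValue τ j α 0 (eisensteinContinuation τ j α 0) :=
    ⟨-(1 / 4), eisensteinContinuation τ j α, by norm_num,
      differentiableOn_eisensteinContinuation τ hj α,
      fun w _ hw => eisensteinContinuation_eq τ hj α hw, rfl⟩
  have hex : ∃ e, IsContinuedValue τ j α 0 e := ⟨_, h⟩
  rw [eisenstein, dif_pos hex]
  exact hex.choose_spec.unique h

end EllipticEisenstein

/-! ### The Laurent expansion at the origin -/

namespace EllipticEisenstein
open Filter
open scoped ComplexConjugate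

theorem eisensteinTerm_at_zero (j : ℕ) (u : ℂ) : eisensteinTerm j 0 u = 1 / u ^ j := by
  simp [eisensteinTerm]

section
variable {τ : UpperHalfPlane} {Dt : ℂ →₀ ℤ}

theorem exists_norm_sum_eisensteinTerm_le (h0 : (Dt.sum fun _ m => m) = 0)
    (h1 : (Dt.sum fun α m => (m : ℂ) * α) = 0) {j : ℕ} (hj : 1 ≤ j) (B : ℝ) :
    ∃ C R : ℝ, ∀ u s : ℂ, R ≤ ‖u‖ → ‖s‖ ≤ B → -(1 / 4) ≤ s.re →
      ‖∑ α ∈ Dt.support, (Dt α : ℂ) * eisensteinTerm j s (α + u)‖ ≤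
        C * ‖u‖ ^ (-(5 / 2) : ℝ) := by
  obtain ⟨C, R, hC, hR, h⟩ :=
    exists_norm_eisensteinRemainder_le hj B (∑ α ∈ Dt.support, ‖α‖)
  refine ⟨∑ α ∈ Dt.support, ‖(Dt α : ℂ)‖ * C, R, fun u s hu hs hre => ?_⟩
  -- The multiplicities are integers, so the conjugate first moment vanishes too; this kills the
  -- term in conj(α/u).
  have hconj : ∑ α ∈ Dt.support, (Dt α : ℂ) * conj α = 0 := by
    have := congrArg conj (show ∑ α ∈ Dt.support, (Dt α : ℂ) * α = 0 from h1)
    simpa [map_sum] using this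
  have hlin := sum_mul_affine_eq_zero h0 h1 (eisensteinTerm j s u)
    (-(eisensteinTerm j s u * (j + s) / u))
  have hrw : ∑ α ∈ Dt.support, (Dt α : ℂ) * eisensteinTerm j s (α + u) =
      ∑ α ∈ Dt.support, (Dt α : ℂ) * eisensteinRemainder j s u α := by
    have h2 : ∑ α ∈ Dt.support, (Dt α : ℂ) * eisensteinRemainder j s u α =
        ∑ α ∈ Dt.support, (Dt α : ℂ) * eisensteinTerm j s (α + u) -
          ∑ α ∈ Dt.support, (Dt α : ℂ) *
            (eisensteinTerm j s u + -(eisensteinTerm j s u * (j + s) / u) * α) +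
          eisensteinTerm j s u * s / conj u * ∑ α ∈ Dt.support, (Dt α : ℂ) * conj α := by
      rw [Finset.mul_sum, ← Finset.sum_sub_distrib, ← Finset.sum_add_distrib]
      refine Finset.sum_congr rfl fun α _ => ?_
      rw [eisensteinRemainder, add_comm u α, map_div₀]
      ring
    rw [h2, hlin, hconj]
    ring
  rw [hrw, Finset.sum_mul]
  refine (norm_sum_le _ _).trans (Finset.sum_le_sum fun α hα => ?_)
  rw [norm_mul, mul_assoc]
  exact mul_le_mul_of_nonneg_left (h s u α hs hre hu (Finset.single_le_sum
    (f := fun α : ℂ => ‖α‖) (fun _ _ => norm_nonneg _) hα)) (norm_nonneg _)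

/-- For a principal lift, the series of the divisor converges absolutely beyond `s = 0`, to the
analytic continuation. -/
theorem summable_and_eisensteinDivisor_eq (τ : UpperHalfPlane) (h0 : (Dt.sum fun _ m => m) = 0)
    (h1 : (Dt.sum fun α m => (m : ℂ) * α) = 0) {j : ℕ} (hj : 1 ≤ j) :
    (Summable fun ω : lattice τ => ‖∑ α ∈ Dt.support, (Dt α : ℂ) * (1 / (α + (ω : ℂ)) ^ j)‖) ∧
      eisensteinDivisor τ j Dt 0 =
        ∑' ω : lattice τ, ∑ α ∈ Dt.support, (Dt α : ℂ) * (1 / (α + (ω : ℂ)) ^ j) := by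
  obtain ⟨hd, hs⟩ := differentiableOn_tsum_lattice (τ := τ) (α := 0)
    (A := fun ω s => ∑ α ∈ Dt.support, (Dt α : ℂ) * eisensteinTerm j s (α + (ω : ℂ)))
    (fun ω => Differentiable.fun_sum fun α _ => (differentiable_eisensteinTerm hj _).const_mul _)
    (fun B => by
      obtain ⟨C, R, h⟩ := exists_norm_sum_eisensteinTerm_le h0 h1 hj B
      refine ⟨C, R, fun ω s => ?_⟩
      rw [zero_add]
      exact h ω s)
  have hopen : IsOpen {s : ℂ | -(1 / 4) < s.re} := isOpen_lt continuous_const Complex.continuous_re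
  have hA := hd.analyticOnNhd hopen
  have hd2 : DifferentiableOn ℂ
      (fun s => ∑ α ∈ Dt.support, (Dt α : ℂ) * eisensteinContinuation τ j α s)
      {s : ℂ | -(1 / 4) < s.re} := DifferentiableOn.fun_sum fun α _ =>
    (differentiableOn_eisensteinContinuation τ hj α).const_mul _
  -- Near s = 2 every series converges absolutely, so the sums over α and ω commute.
  have hev : (fun s => ∑ α ∈ Dt.support, (Dt α : ℂ) * eisensteinContinuation τ j α s) =ᶠ[𝓝 2]
      fun s => ∑' ω : lattice τ,
        ∑ α ∈ Dt.support, (Dt α : ℂ) * eisensteinTerm j s (α + (ω : ℂ)) := by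
    have ho : IsOpen {s : ℂ | 1 < s.re} := isOpen_lt continuous_const Complex.continuous_re
    filter_upwards [ho.mem_nhds (by simp : (2 : ℂ) ∈ {s : ℂ | 1 < s.re})] with s hs
    have hs1 : 1 < s.re := hs
    have hs2 : 1 - (j : ℝ) / 2 < s.re := by
      have : (0 : ℝ) ≤ j := Nat.cast_nonneg j
      linarith
    rw [Summable.tsum_finsetSum fun α _ => (summable_eisensteinTerm τ α hs2).mul_left _]
    refine Finset.sum_congr rfl fun α _ => ?_
    rw [eisensteinContinuation_eq τ hj α hs2, eisensteinSeries_eq_tsum τ hj, tsum_mul_left]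
  have heq := (hd2.analyticOnNhd hopen).eqOn_of_preconnected_of_eventuallyEq hA
    (convex_halfSpace_re_gt _).isPreconnected (by norm_num : (2 : ℂ) ∈ {s : ℂ | -(1 / 4) < s.re})
    hev (by norm_num : (0 : ℂ) ∈ {s : ℂ | -(1 / 4) < s.re})
  simp only [eisensteinTerm_at_zero] at heq
  refine ⟨?_, ?_⟩
  · simpa only [eisensteinTerm_at_zero] using hs 0 (by norm_num)
  · rw [← heq]
    exact Finset.sum_congr rfl fun α _ => congrArg _ (eisenstein_zero_eq τ hj α)

theorem eisensteinContinuation_add (τ : UpperHalfPlane) (j : ℕ) (α s : ℂ) (ω₀ : lattice τ) :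
    eisensteinContinuation τ j (α + (ω₀ : ℂ)) s = eisensteinContinuation τ j α s := by
  rw [eisensteinContinuation, eisensteinContinuation, ← (Equiv.addLeft ω₀).tsum_eq
    (fun ω : lattice τ => eisensteinDefect τ j s (α + (ω : ℂ)))]
  refine tsum_congr fun ω => ?_
  rw [Equiv.coe_addLeft, Submodule.coe_add, add_assoc]

theorem eisenstein_congr {j : ℕ} (hj : 1 ≤ j) {α β : ℂ} (h : point τ α = point τ β) :
    eisenstein τ j α 0 = eisenstein τ j β 0 := by
  rw [eisenstein_zero_eq τ hj, eisenstein_zero_eq τ hj]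
  have := eisensteinContinuation_add τ j α 0 ⟨β - α, point_eq_point_iff.mp h⟩
  rw [← this]
  simp

/-- The value at s = 0 depends only on P_α, so the sum descends to D and any two lifts give the same
result. -/
theorem IsLift.eisensteinDivisor_eq {D : Curve τ →₀ ℤ} (h : IsLift τ Dt D) {j : ℕ} (hj : 1 ≤ j) :
    eisensteinDivisor τ j Dt 0 =
      D.sum fun P m => (m : ℂ) * eisenstein τ j (Quotient.out P) 0 := by
  rw [← h, Finsupp.sum_mapDomain_index (by simp) (by intros; push_cast; ring)]
  refine Finsupp.sum_congr fun α _ => ?_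
  rw [eisenstein_congr hj (β := Quotient.out (point τ α))
    (Quotient.out_eq (s := _) (point τ α)).symm]

theorem exists_pos_le_norm_add (τ : UpperHalfPlane) (s : Finset ℂ) :
    ∃ ρ : ℝ, 0 < ρ ∧ ∀ α ∈ s, ∀ ω : lattice τ, α + (ω : ℂ) ≠ 0 → ρ ≤ ‖α + (ω : ℂ)‖ := by
  have h : ∀ᶠ ρ : ℝ in 𝓝[>] 0, ∀ α ∈ s, ∀ ω : lattice τ, α + (ω : ℂ) ≠ 0 →
      ρ ≤ ‖α + (ω : ℂ)‖ := by
    refine (Finset.eventually_all _).mpr fun α _ => ?_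
    obtain ⟨ε, hε, hball⟩ := Metric.mem_nhds_iff.mp
      ((periods τ).compl_lattice_sdiff_singleton_mem_nhds (-α))
    filter_upwards [Ioo_mem_nhdsGT hε] with ρ hρ ω hω
    by_contra hlt
    have hm : (ω : ℂ) ∈ Metric.ball (-α) ε := by
      rw [mem_ball_iff_norm, sub_neg_eq_add, add_comm]
      exact (not_le.mp hlt).trans hρ.2
    refine hball hm ⟨ω.2, fun h => hω ?_⟩
    rw [show (ω : ℂ) = -α from h, add_neg_cancel]
  obtain ⟨ρ, h1, h2⟩ := (h.and self_mem_nhdsWithin).exists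
  exact ⟨ρ, h2, h1⟩

/-- For β = 0 all terms are 0 by 1/0 = 0, which matches the omission of ω = -α in the Eisenstein
series. -/
theorem hasSum_geometric_pole {z β : ℂ} (h : β = 0 ∨ ‖z‖ < ‖β‖) :
    HasSum (fun n : ℕ => -(1 / β ^ (n + 1) * z ^ n)) (if β = 0 then 0 else 1 / (z - β)) := by
  by_cases hβ : β = 0
  · simp only [hβ, if_true]
    simp
  · have hlt := h.resolve_left hβ
    have hz : ‖z / β‖ < 1 := by
      rw [norm_div, div_lt_one (norm_pos_iff.mpr hβ)]
      exact hlt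
    have hne : z - β ≠ 0 := fun h => by
      rw [sub_eq_zero.mp h] at hlt
      exact lt_irrefl _ hlt
    have hne' : β - z ≠ 0 := fun h => hne (by linear_combination -h)
    rw [if_neg hβ]
    have hval : 1 / (z - β) = -(1 / β) * (1 - z / β)⁻¹ := by
      have : 1 - z / β = (β - z) / β := by field_simp
      rw [this, inv_div, neg_mul, one_div_mul_eq_div, div_div_cancel_left' hβ,
        ← neg_sub β z, one_div, inv_neg]
    rw [hval]
    refine ((hasSum_geometric_of_norm_lt_one hz).mul_left (-(1 / β))).congr_fun fun n => ?_
    rw [div_pow, pow_succ]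
    field_simp

theorem IsLift.apply_zero {D : Curve τ →₀ ℤ} (h : IsLift τ Dt D)
    (h_zero : ∀ α ∈ Dt.support, α ∈ lattice τ → α = 0) : D 0 = Dt 0 := by
  classical
  have : D 0 = D (point τ 0) := rfl
  rw [this, h.apply]
  have h1 : ∀ α ∈ Dt.support, (if point τ α = point τ 0 then Dt α else 0) =
      if α = 0 then Dt α else 0 := by
    intro α hα
    refine if_congr ⟨fun hp => h_zero α hα ?_, fun hp => by rw [hp]⟩ rfl rfl
    simpa using point_eq_point_iff.mp hp
  rw [Finset.sum_congr rfl h1, Finset.sum_ite_eq']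
  split_ifs with hs
  · rfl
  · exact (Finsupp.notMem_support_iff.mp hs).symm

theorem hasSum_swap {ι κ : Type*} {f : ι × κ → ℂ} (hf : Summable f) {g : ι → ℂ} {h : κ → ℂ}
    (hg : ∀ i, HasSum (fun k => f (i, k)) (g i)) (hh : ∀ k, HasSum (fun i => f (i, k)) (h k))
    {a : ℂ} (ha : HasSum g a) : HasSum h a := by
  have h2 : HasSum (fun p : κ × ι => f (p.2, p.1)) (∑' p, f p) :=
    (Equiv.prodComm κ ι).hasSum_iff.mpr hf.hasSum
  rw [ha.unique (hf.hasSum.prod_fiberwise hg)]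
  exact h2.prod_fiberwise hh

/-- Expanding the poles α + ω in powers of z gives a double series in (ω, n): summed over n it is
the lattice term without its pole at 0, summed over ω it is an Eisenstein coefficient. -/
theorem hasSum_laurent {D : Curve τ →₀ ℤ} (hDt : IsPrincipalLift τ Dt D)
    (h_zero : ∀ α ∈ Dt.support, α ∈ lattice τ → α = 0) :
    ∀ᶠ z in 𝓝[≠] (0 : ℂ), z ∈ regularSet τ Dt ∧
      HasSum (fun n : ℕ => -eisensteinDivisor τ (n + 1) Dt 0 * z ^ n)
        ((∑' ω : lattice τ, latticeTerm Dt (ω : ℂ) z) - (D 0 : ℂ) / z) := by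
  classical
  have h0 := hDt.degree_eq_zero
  have h1 := hDt.sum_eq_zero
  obtain ⟨ρ, hρ, hle⟩ := exists_pos_le_norm_add τ Dt.support
  filter_upwards [self_mem_nhdsWithin, mem_nhdsWithin_of_mem_nhds (Metric.ball_mem_nhds 0 hρ)]
    with z hz hzρ
  have hz0 : z ≠ 0 := hz
  rw [mem_ball_zero_iff] at hzρ
  have hreg : z ∈ regularSet τ Dt := by
    intro α hα hL
    have := hle α hα ⟨z - α, hL⟩ (by simpa using hz0)
    rw [add_sub_cancel] at this
    linarith
  refine ⟨hreg, ?_⟩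
  set t : lattice τ → ℕ → ℂ := fun ω n =>
    ∑ α ∈ Dt.support, (Dt α : ℂ) * (1 / (α + (ω : ℂ)) ^ (n + 1)) with ht
  set g : lattice τ → ℝ := fun ω =>
    ∑ α ∈ Dt.support, ‖(Dt α : ℂ)‖ * ‖α + (ω : ℂ)‖⁻¹ ^ 3 with hg
  -- For n ≥ 2 the bound |α + ω|⁻³ is summable for each α separately. For n = 0, 1 only the sums
  -- over α are summable, so their norms enter the majorant directly.
  set b : lattice τ → ℝ := fun ω => ‖t ω 0‖ + ρ * ‖t ω 1‖ + ρ ^ 2 * g ω with hb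
  have hgs : Summable g := by
    refine summable_sum fun α _ => Summable.mul_left _ ?_
    refine (ZLattice.summable_norm_sub_inv_pow (lattice τ) 3 (by simp) (-α)).congr fun ω => ?_
    rw [sub_neg_eq_add, add_comm]
  have hts : ∀ n, Summable fun ω => ‖t ω n‖ := fun n =>
    (summable_and_eisensteinDivisor_eq τ h0 h1 (Nat.le_add_left 1 n)).1
  have hbs : Summable b := ((hts 0).add ((hts 1).mul_left ρ)).add (hgs.mul_left _)
  have hg0 : ∀ ω, 0 ≤ g ω := fun ω => Finset.sum_nonneg fun α _ => by positivity
  have htb : ∀ ω n, ‖t ω n‖ ≤ b ω * (ρ⁻¹) ^ n := by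
    intro ω n
    match n with
    | 0 =>
      have := hg0 ω
      rw [pow_zero, mul_one, hb]
      have : 0 ≤ ρ * ‖t ω 1‖ + ρ ^ 2 * g ω := by positivity
      linarith
    | 1 =>
      have := hg0 ω
      rw [pow_one, ← div_eq_mul_inv, le_div_iff₀ hρ, hb]
      have : 0 ≤ ‖t ω 0‖ + ρ ^ 2 * g ω := by positivity
      linarith
    | n + 2 =>
      have hgb : ρ ^ 2 * g ω ≤ b ω := by
        rw [hb]
        have : 0 ≤ ‖t ω 0‖ + ρ * ‖t ω 1‖ := by positivity
        linarith
      have h2 : ‖t ω (n + 2)‖ ≤ g ω * ρ⁻¹ ^ n := by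
        rw [ht, hg, Finset.sum_mul]
        refine (norm_sum_le _ _).trans (Finset.sum_le_sum fun α hα => ?_)
        rw [norm_mul, mul_assoc]
        refine mul_le_mul_of_nonneg_left ?_ (norm_nonneg _)
        rw [norm_div, norm_one, norm_pow, one_div, ← inv_pow,
          show n + 2 + 1 = 3 + n by ring, pow_add]
        by_cases hβ : α + (ω : ℂ) = 0
        · rw [hβ]
          simp
        · have := hle α hα ω hβ
          gcongr
      refine h2.trans ?_
      calc g ω * ρ⁻¹ ^ n = ρ ^ 2 * g ω * ρ⁻¹ ^ (n + 2) := by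
            have : ρ ^ 2 * ρ⁻¹ ^ 2 = 1 := by rw [← mul_pow, mul_inv_cancel₀ hρ.ne', one_pow]
            rw [pow_add]
            linear_combination (-(g ω * ρ⁻¹ ^ n)) * this
        _ ≤ _ := by gcongr
  set f : lattice τ × ℕ → ℂ := fun p => -(t p.1 p.2 * z ^ p.2) with hf
  have hfs : Summable f := by
    have hgeo : Summable fun n : ℕ => (ρ⁻¹ * ‖z‖) ^ n := by
      refine summable_geometric_of_lt_one (by positivity) ?_
      rw [inv_mul_lt_iff₀ hρ]
      linarith
    have hb0 : 0 ≤ b := fun ω => by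
      have := hg0 ω
      simp only [hb, Pi.zero_apply]
      positivity
    refine Summable.of_norm_bounded
      (hbs.mul_of_nonneg hgeo hb0 fun n => by simp only [Pi.zero_apply]; positivity) fun p => ?_
    rw [hf, norm_neg, norm_mul, norm_pow, mul_pow, ← mul_assoc]
    exact mul_le_mul_of_nonneg_right (htb p.1 p.2) (by positivity)
  -- By `h_zero` the pole at 0 can come only from α = 0, ω = 0.
  have hrow : ∀ ω : lattice τ, HasSum (fun n => f (ω, n))
      (latticeTerm Dt (ω : ℂ) z - if ω = 0 then (D 0 : ℂ) / z else 0) := by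
    intro ω
    have h2 : HasSum (fun n => f (ω, n)) (∑ α ∈ Dt.support, (Dt α : ℂ) *
        (if α + (ω : ℂ) = 0 then 0 else 1 / (z - (α + (ω : ℂ))))) := by
      have h3 := hasSum_sum (s := Dt.support) fun α hα =>
        (hasSum_geometric_pole (z := z) (β := α + (ω : ℂ)) (by
          by_cases hβ : α + (ω : ℂ) = 0
          · exact Or.inl hβ
          · exact Or.inr (hzρ.trans_le (hle α hα ω hβ)))).mul_left (Dt α : ℂ)
      refine h3.congr_fun fun n => ?_
      simp only [hf, ht, Finset.sum_mul, ← Finset.sum_neg_distrib]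
      exact Finset.sum_congr rfl fun α _ => by ring
    convert h2 using 1
    have h4 : (if ω = 0 then (D 0 : ℂ) / z else 0) =
        ∑ α ∈ Dt.support, if α + (ω : ℂ) = 0 then (Dt α : ℂ) / z else 0 := by
      by_cases hω : ω = 0
      · subst hω
        simp only [if_true, Submodule.coe_zero, add_zero]
        rw [hDt.isLift.apply_zero h_zero, Finset.sum_ite_eq']
        split_ifs with hs
        · rfl
        · simp [Finsupp.notMem_support_iff.mp hs]
      · rw [if_neg hω, eq_comm]
        refine Finset.sum_eq_zero fun α hα => if_neg fun h => hω ?_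
        have hα0 : α = 0 := h_zero α hα (by
          rw [eq_neg_of_add_eq_zero_left h]
          exact neg_mem ω.2)
        rw [hα0, zero_add] at h
        exact Subtype.ext h
    rw [h4, latticeTerm, Finsupp.sum, ← Finset.sum_sub_distrib]
    refine Finset.sum_congr rfl fun α _ => ?_
    by_cases hβ : α + (ω : ℂ) = 0
    · rw [if_pos hβ, if_pos hβ, sub_sub, hβ]
      simp
    · rw [if_neg hβ, if_neg hβ, sub_sub]
      ring
  have hcol : ∀ n : ℕ, HasSum (fun ω => f (ω, n))
      (-eisensteinDivisor τ (n + 1) Dt 0 * z ^ n) := by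
    intro n
    have he : eisensteinDivisor τ (n + 1) Dt 0 = ∑' ω, t ω n :=
      (summable_and_eisensteinDivisor_eq τ h0 h1 (Nat.le_add_left 1 n)).2
    have hs : HasSum (fun ω => t ω n) (∑' ω, t ω n) := (hts n).of_norm.hasSum
    rw [he, neg_mul]
    exact (hs.mul_right (z ^ n)).neg
  exact hasSum_swap hfs hrow hcol
    ((hasSum_latticeTerm_zeta τ h0 h1 z).summable.hasSum.sub (hasSum_ite_eq 0 _))

end

end EllipticEisenstein

end

theorem theorem2p8 (τ : UpperHalfPlane) (D : EllipticEisenstein.Curve τ →₀ ℤ)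
    (hD : EllipticEisenstein.IsPrincipal τ D) (Dt : ℂ →₀ ℤ)
    (hDt : EllipticEisenstein.IsPrincipalLift τ Dt D)
    (h_zero : ∀ α ∈ Dt.support, α ∈ EllipticEisenstein.lattice τ → α = 0) :
    (∃! f : ℂ → ℂ, EllipticEisenstein.IsNormalizedFunction τ D f) ∧
    ∀ f : ℂ → ℂ, EllipticEisenstein.IsNormalizedFunction τ D f →
      -- the logarithmic derivative is the sum of zeta functions
      (∀ z ∈ EllipticEisenstein.regularSet τ Dt,
        logDeriv f z =
          Dt.sum fun α m => (m : ℂ) * EllipticEisenstein.weierstrassZeta τ (z - α)) ∧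
      -- it is the sum of the lattice series, which converges absolutely,
      (∀ z ∈ EllipticEisenstein.regularSet τ Dt,
        Summable (fun ω : EllipticEisenstein.lattice τ =>
          ‖EllipticEisenstein.latticeTerm Dt (ω : ℂ) z‖) ∧
        HasSum (fun ω : EllipticEisenstein.lattice τ =>
          EllipticEisenstein.latticeTerm Dt (ω : ℂ) z) (logDeriv f z)) ∧
      -- locally uniformly,
      HasSumLocallyUniformlyOn (fun (ω : EllipticEisenstein.lattice τ) (z : ℂ) =>
          EllipticEisenstein.latticeTerm Dt (ω : ℂ) z) (logDeriv f)
        (EllipticEisenstein.regularSet τ Dt) ∧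
      -- with terms `O(1 / |ω| ^ 3)`, uniformly for `z` in a compact set
      (∀ K : Set ℂ, IsCompact K → ∃ C R : ℝ, ∀ z ∈ K, ∀ ω : EllipticEisenstein.lattice τ,
        R ≤ ‖(ω : ℂ)‖ → ‖EllipticEisenstein.latticeTerm Dt (ω : ℂ) z‖ ≤ C / ‖(ω : ℂ)‖ ^ 3) ∧
      -- the Laurent expansion at the origin, for `D` supported on the `ℓ`-torsion
      (∀ ℓ : ℕ, 1 ≤ ℓ → (∀ P ∈ D.support, ℓ • P = 0) →
        ∀ D' : ℂ →₀ ℤ, EllipticEisenstein.IsLift τ D' D →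
          ∀ᶠ z in 𝓝[≠] (0 : ℂ),
            HasSum (fun n : ℕ => -EllipticEisenstein.eisensteinDivisor τ (n + 1) D' 0 * z ^ n)
              (logDeriv f z - (D 0 : ℂ) / z)) := by
  obtain ⟨f₀, hf₀⟩ := EllipticEisenstein.exists_isNormalizedFunction hD
  have h0 := hDt.degree_eq_zero
  have h1 := hDt.sum_eq_zero
  refine ⟨⟨f₀, hf₀, fun g hg => hg.eq hf₀⟩, fun f hf => ?_⟩
  have hlog := fun z (hz : z ∈ EllipticEisenstein.regularSet τ Dt) =>
    EllipticEisenstein.logDeriv_eq_tsum_latticeTerm hDt hf hz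
  have hzeta := fun z (hz : z ∈ EllipticEisenstein.regularSet τ Dt) =>
    (hlog z hz).trans (EllipticEisenstein.hasSum_latticeTerm_zeta τ h0 h1 z).tsum_eq
  refine ⟨hzeta, fun z hz => ⟨EllipticEisenstein.summable_norm_latticeTerm τ h0 h1 z, ?_⟩, ?_,
    fun K hK => ?_, fun ℓ _ _ D' hD' => ?_⟩
  · rw [hzeta z hz]
    exact EllipticEisenstein.hasSum_latticeTerm_zeta τ h0 h1 z
  · refine TendstoLocallyUniformlyOn.congr_right
      (EllipticEisenstein.hasSumLocallyUniformlyOn_latticeTerm τ h0 h1) fun z hz => ?_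
    exact (hzeta z hz).symm
  · obtain ⟨B, hB⟩ := hK.isBounded.exists_norm_le
    obtain ⟨C, R, h⟩ := EllipticEisenstein.exists_norm_latticeTerm_le h0 h1 B
    exact ⟨C, R, fun z hz ω hω => h z ω (hB z hz) hω⟩
  · filter_upwards [EllipticEisenstein.hasSum_laurent hDt h_zero] with z hz
    rw [hlog z hz.1]
    refine hz.2.congr_fun fun n => ?_
    -- Both lifts are compared through D.
    rw [hD'.eisensteinDivisor_eq (Nat.le_add_left 1 n),
      hDt.isLift.eisensteinDivisor_eq (Nat.le_add_left 1 n)]
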